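/- Let $\Gamma=(\mathbb V,E)$ be a connected simple graph on a countably infinite vertex set, with graph metric $d$ and uniformly bounded degrees, and suppose that $\#\{y: d(x,y)=r\}\le C_U r^{z-1}$ for all $x\in\mathbb V$ and all integers $r\ge 1$, for some constants $C_U>0$, $z\ge 1$. For a function $f$ on $\mathbb V$ put $$-\Delta^{(p)}f(x)=\frac1{\deg x}\sum_{y\sim x}(f(x)-f(y)),\qquad -\Delta^{(c)}f(x)=\sum_{y\sim x}(f(x)-f(y)).$$ For a nonempty finite set $A\subset\mathbb V$ let $-\Delta_A^{(p)}$ and $-\Delta_A^{(c)}$ be the restrictions of these operators to $A$ with Dirichlet boundary conditions, that is, the matrices with entries $\langle x|H|y\rangle=(H\mathbb 1_y)(x)$, $x,y\in A$. Let $u_A=(-\Delta_A^{(p)})^{-1}\mathbb 1_A$ and $\widetilde u_A=(-\Delta_A^{(c)})^{-1}\mathbb 1_A$ be their landscape (torsion) functions, and $\lambda_A$, $\widetilde\lambda_A$ their smallest eigenvalues. Let $\partial A=\{y\notin A:\exists x\in A,\ x\sim y\}$, $\delta(x)=\min_{y\in\partial A}d(x,y)$ for $x\in A$, and let $\rho_A=\max_{x\in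 A}\delta(x)$ be the inradius of $A$. Let $k_1,\dots,k_5>0$ and $C_A>0$ be constants. Then there are constants $c_1,c_2,c_3,c_4>0$, depending only on $\Gamma$ (with its growth constants $C_U,z$), on $k_1,\dots,k_5$ and on $C_A$, such that the following holds for every nonempty finite $A\subset\mathbb V$. Suppose that for all $t>0$ and $x,y\in A$ $$|\langle x|e^{t\Delta_A^{(p)}}|y\rangle|\le\begin{cases}k_1t^{-z/2}\exp(-k_2d(x,y)^2/t),& d(x,y)\ge1,\ t\ge d(x,y),\\ k_3\exp(-k_4d(x,y)),& d(x,y)\ge1,\ t<d(x,y),\\ k_5t^{-z/2},& x=y,\end{cases}$$ and that the Hardy type inequality $$C_A\sum_{x\in A}\ \sum_{y\in\mathbb V:\,y\sim x}|f(y)-f(x)|^2\ \ge\ \sum_{x\in A}\frac{\deg(x)f(x)^2}{\delta(x)^2}$$ holds for all $f:\mathbb V\to\mathbb R$ vanishing outside $A$. Then $$c_1\rho_A^2\le\|u_A\|_{\ell^\infty(A)},\ \|\widetilde u_A\|_{\ell^\infty(A)}\le c_2\rho_A^2\qquad\text{and}\qquad c_3\rho_A^{-2}\le\lambda_A,\ \widetilde\lambda_A\le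 c_4\rho_A^{-2}.$$ -/

import Mathlib

namespace GraphLandscape

section Laplacians

variable {V : Type*} (Γ : SimpleGraph V) [Γ.LocallyFinite]

/-- The negative probabilistic Laplacian
`(-Δ⁽ᵖ⁾ f)(x) = (1 / deg x) ∑_{y ∼ x} (f x - f y)` on functions on the vertices. -/
noncomputable def negProbLaplacian : (V → ℝ) →ₗ[ℝ] (V → ℝ) where
  toFun f x := (1 / (Γ.degree x : ℝ)) * ∑ y ∈ Γ.neighborFinset x, (f x - f y)
  map_add' f g := by
    funext x
    simp only [Pi.add_apply, ← mul_add, ← Finset.sum_add_distrib]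
    congr 1
    exact Finset.sum_congr rfl fun y _ => by ring
  map_smul' c f := by
    funext x
    simp only [Pi.smul_apply, smul_eq_mul, RingHom.id_apply, ← mul_sub, ← Finset.mul_sum]
    ring

/-- The negative combinatorial Laplacian `(-Δ⁽ᶜ⁾ f)(x) = ∑_{y ∼ x} (f x - f y)`. -/
noncomputable def negCombLaplacian : (V → ℝ) →ₗ[ℝ] (V → ℝ) where
  toFun f x := ∑ y ∈ Γ.neighborFinset x, (f x - f y)
  map_add' f g := by
    funext x
    simp only [Pi.add_apply, ← Finset.sum_add_distrib]
    exact Finset.sum_congr rfl fun y _ => by ring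
  map_smul' c f := by
    funext x
    simp only [Pi.smul_apply, smul_eq_mul, RingHom.id_apply, ← mul_sub, ← Finset.mul_sum]

end Laplacians

section Restriction

variable {V : Type*} [DecidableEq V]

/-- The restriction `H_A = Π_A H Π_A` of `H` to a finite set `A` of vertices with Dirichlet
boundary conditions, as the matrix with entries `⟨x|H|y⟩ = (H 𝟙_y)(x)`, `x, y ∈ A`.
Degrees occurring in `H` are those of the full graph. -/
def dirichletRestriction (H : (V → ℝ) →ₗ[ℝ] (V → ℝ)) (A : Finset V) : Matrix A A ℝ :=
  Matrix.of fun x y => H (Pi.single (y : V) 1) (x : V)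

/-- The landscape (torsion) function `u_A = H_A⁻¹ 𝟙_A`. -/
noncomputable def landscape (H : (V → ℝ) →ₗ[ℝ] (V → ℝ)) (A : Finset V) : A → ℝ :=
  Matrix.mulVec (dirichletRestriction H A)⁻¹ 1

/-- The ground state energy of `H_A`: its smallest eigenvalue. -/
noncomputable def groundStateEnergy (H : (V → ℝ) →ₗ[ℝ] (V → ℝ)) (A : Finset V) : ℝ :=
  sInf {μ : ℝ | Module.End.HasEigenvalue (Matrix.toLin' (dirichletRestriction H A)) μ}

/-- The matrix elements `⟨x|e^{-tH_A}|y⟩` of the semigroup generated by `-H_A`. -/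
noncomputable def semigroupKernel (H : (V → ℝ) →ₗ[ℝ] (V → ℝ)) (A : Finset V) (t : ℝ)
    (x y : A) : ℝ :=
  NormedSpace.exp ((-t) • dirichletRestriction H A) x y

/-- The semigroup kernel upper bounds for `H_A` with exponent `z` and constants `k₁, …, k₅`. -/
def SemigroupKernelBounds (Γ : SimpleGraph V) (H : (V → ℝ) →ₗ[ℝ] (V → ℝ)) (A : Finset V)
    (z k₁ k₂ k₃ k₄ k₅ : ℝ) : Prop :=
  ∀ t : ℝ, 0 < t → ∀ x y : A,
    (1 ≤ Γ.dist (x : V) y → (Γ.dist (x : V) y : ℝ) ≤ t →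
      |semigroupKernel H A t x y|
        ≤ k₁ * t ^ (-z / 2) * Real.exp (-k₂ * (Γ.dist (x : V) y : ℝ) ^ 2 / t)) ∧
    (1 ≤ Γ.dist (x : V) y → t < (Γ.dist (x : V) y : ℝ) →
      |semigroupKernel H A t x y| ≤ k₃ * Real.exp (-k₄ * (Γ.dist (x : V) y : ℝ))) ∧
    (x = y → |semigroupKernel H A t x y| ≤ k₅ * t ^ (-z / 2))

end Restriction

section Geometry

variable {V : Type*} (Γ : SimpleGraph V)

/-- Volume growth of spheres: `#{y : d(x, y) = r} ≤ C_U r^{z-1}` for all `x` and `r ≥ 1`. -/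
def SphereGrowth (CU z : ℝ) : Prop :=
  ∀ (x : V) (r : ℕ), 1 ≤ r → ({y : V | Γ.dist x y = r}.ncard : ℝ) ≤ CU * (r : ℝ) ^ (z - 1)

/-- The exterior boundary `∂A`. -/
def extBoundary (A : Finset V) : Set V := {y : V | y ∉ A ∧ ∃ x ∈ A, Γ.Adj x y}

/-- The distance `δ(x) = min_{y ∈ ∂A} d(x, y)`. -/
noncomputable def distToBoundary (A : Finset V) (x : V) : ℕ :=
  sInf ((fun y => Γ.dist x y) '' extBoundary Γ A)

/-- The inradius `ρ_A = max_{x ∈ A} δ(x)`. -/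
noncomputable def inradius (A : Finset V) : ℕ := A.sup (distToBoundary Γ A)

/-- The Hardy type inequality for the Dirichlet Laplacian on `A`, with constant `C`.
The functions in `ℓ²(A)` are extended by zero outside `A`, and the energy
includes the edges from `A` to `∂A`. -/
def HardyInequality [Γ.LocallyFinite] (A : Finset V) (C : ℝ) : Prop :=
  ∀ f : V → ℝ, (∀ x, x ∉ A → f x = 0) →
    ∑ x ∈ A, (Γ.degree x : ℝ) * f x ^ 2 / (distToBoundary Γ A x : ℝ) ^ 2
      ≤ C * ∑ x ∈ A, ∑ y ∈ Γ.neighborFinset x, |f y - f x| ^ 2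

end Geometry

end GraphLandscape

/-! Both Dirichlet operators have the form `W⁻¹L` with the same symmetric matrix `L`, the
combinatorial Dirichlet Laplacian, and `W` the degrees or the identity. Everything is thus expressed
through one quadratic form, and degrees between 1 and `M` make the two weights comparable.

Since δ ≤ ρ, Hardy's inequality gives a spectral gap c = (2 C_A ρ²)⁻¹ (`spectral_gap_of_hardy`),
which is the lower eigenvalue bound. For the upper landscape bound, a geometric mean of the kernel
bounds with the decay from the gap, summed over spheres, gives ∑_y |e^{-tH}(x,y)| ≤ C e^{-ct/4}
(`exists_sum_semigroupKernel_le`). Integrating in time bounds every v with |Hv| ≤ 1 by 4C/c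
(`exists_abs_le_of_poisson`). The combinatorial landscape satisfies this too, because the
probabilistic operator maps it to 1/deg.

The upper eigenvalue bound tests the form with a tent function on a ball of radius comparable to ρ
around a deepest point of A. Its Rayleigh quotient is of order ρ⁻² if the volumes of concentric
balls with radii in ratio 2 are comparable. The upper volume bound is assumed. The lower one is not,
and follows from the on-diagonal kernel bound through a Faber–Krahn inequality and a dyadic
induction (`faberKrahn`, `exists_volume_lower_bound`). Finally the minimum principle gives 1 ≤ ν‖u‖
for every eigenvalue ν, so the upper eigenvalue bound becomes the lower landscape bound. -/

namespace GraphLandscape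

open Matrix

/-! ### Spectral calculus for `W⁻¹L` with `L` symmetric -/

section WeightedMatrices

variable {ι : Type*} [Fintype ι] [DecidableEq ι]

/-- `W⁻¹ L = Q diag(μ) Q⁻¹` with `Q` orthonormal for the inner product of weight `w`. -/
structure IsSpectralDecomposition (L : Matrix ι ι ℝ) (w : ι → ℝ) (Q : Matrix ι ι ℝ)
    (μ : ι → ℝ) : Prop where
  mul_inv : Q * (Qᵀ * diagonal w) = 1
  inv_mul : Qᵀ * diagonal w * Q = 1
  eq : diagonal (fun x => (w x)⁻¹) * L = Q * diagonal μ * (Qᵀ * diagonal w)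

/-- Conjugation by W^{1/2} turns `W⁻¹L` into the symmetric matrix W^{-1/2} L W^{-1/2}. If U
diagonalises the latter, then Q = W^{-1/2} U. -/
theorem exists_isSpectralDecomposition {L : Matrix ι ι ℝ} (hL : L.IsSymm) {w : ι → ℝ}
    (hw : ∀ x, 0 < w x) : ∃ Q μ, IsSpectralDecomposition L w Q μ := by
  set R : Matrix ι ι ℝ := diagonal fun x => (Real.sqrt (w x))⁻¹ with hR
  set P : Matrix ι ι ℝ := diagonal fun x => Real.sqrt (w x) with hP
  have hs : ∀ x, Real.sqrt (w x) ≠ 0 := fun x => (Real.sqrt_pos.2 (hw x)).ne'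
  have hRP : R * P = 1 := by
    rw [hR, hP, diagonal_mul_diagonal, ← diagonal_one]
    congr 1; funext x; exact inv_mul_cancel₀ (hs x)
  have hPP : P * P = diagonal w := by
    rw [hP, diagonal_mul_diagonal]
    congr 1; funext x; exact Real.mul_self_sqrt (hw x).le
  have hPR : P * R = 1 := by
    rw [hR, hP, diagonal_mul_diagonal, ← diagonal_one]
    congr 1; funext x; exact mul_inv_cancel₀ (hs x)
  have hRR : R * R = diagonal fun x => (w x)⁻¹ := by
    rw [hR, diagonal_mul_diagonal]
    congr 1; funext x; rw [← mul_inv, Real.mul_self_sqrt (hw x).le]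
  have hRt : Rᵀ = R := diagonal_transpose _
  have hS : (R * L * R).IsHermitian := by
    rw [IsHermitian, conjTranspose_eq_transpose_of_trivial, transpose_mul, transpose_mul, hRt,
      hL.eq, Matrix.mul_assoc]
  obtain ⟨U, ev, hUU, hUU', hspec⟩ : ∃ (U : Matrix ι ι ℝ) (ev : ι → ℝ),
      U * Uᵀ = 1 ∧ Uᵀ * U = 1 ∧ R * L * R = U * diagonal ev * Uᵀ := by
    refine ⟨hS.eigenvectorUnitary, hS.eigenvalues, ?_, ?_, ?_⟩
    · exact Unitary.coe_mul_star_self hS.eigenvectorUnitary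
    · exact Unitary.coe_star_mul_self hS.eigenvectorUnitary
    · have := hS.spectral_theorem
      rw [Unitary.conjStarAlgAut_apply, star_eq_conjTranspose,
        conjTranspose_eq_transpose_of_trivial] at this
      exact this
  have hQ : (R * U)ᵀ * diagonal w = Uᵀ * P := by
    rw [transpose_mul, hRt, ← hPP, Matrix.mul_assoc, ← Matrix.mul_assoc R, hRP, Matrix.one_mul]
  refine ⟨R * U, ev, ?_, ?_, ?_⟩
  · rw [hQ, Matrix.mul_assoc, ← Matrix.mul_assoc U, hUU, Matrix.one_mul, hRP]
  · rw [hQ, Matrix.mul_assoc, ← Matrix.mul_assoc P, hPR, Matrix.one_mul, hUU']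
  · rw [hQ, ← hRR]
    calc R * R * L = R * (R * L * R) * P := by
          simp only [Matrix.mul_assoc, hRP, Matrix.mul_one]
      _ = _ := by rw [hspec]; simp only [Matrix.mul_assoc]

namespace IsSpectralDecomposition

variable {L Q : Matrix ι ι ℝ} {w μ : ι → ℝ}

/-- The coefficients of `f` in the eigenbasis. -/
def coeff (Q : Matrix ι ι ℝ) (w f : ι → ℝ) : ι → ℝ := (Qᵀ * diagonal w) *ᵥ f

theorem exp_eq (h : IsSpectralDecomposition L w Q μ) (t : ℝ) :
    NormedSpace.exp ((-t) • (diagonal (fun x => (w x)⁻¹) * L)) =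
      Q * diagonal (fun i => Real.exp (-(t * μ i))) * (Qᵀ * diagonal w) := by
  have hinv : Q⁻¹ = Qᵀ * diagonal w := Matrix.inv_eq_right_inv h.mul_inv
  have hunit : IsUnit Q := IsUnit.of_mul_eq_one _ h.mul_inv
  rw [h.eq, ← hinv, ← Matrix.smul_mul, ← Matrix.mul_smul, Matrix.exp_conj _ _ hunit,
    ← diagonal_smul, Matrix.exp_diagonal]
  congr 3
  funext i
  rw [Pi.coe_exp, Real.exp_eq_exp_ℝ]
  simp

theorem exp_apply (h : IsSpectralDecomposition L w Q μ) (t : ℝ) (x y : ι) :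
    NormedSpace.exp ((-t) • (diagonal (fun x => (w x)⁻¹) * L)) x y =
      ∑ i, Q x i * Real.exp (-(t * μ i)) * (Q y i * w y) := by
  rw [h.exp_eq, Matrix.mul_apply]
  refine Finset.sum_congr rfl fun i _ => ?_
  rw [mul_diagonal, mul_diagonal, transpose_apply]

theorem sum_mul_self (h : IsSpectralDecomposition L w Q μ) (x : ι) :
    ∑ i, Q x i * (Q x i * w x) = 1 := by
  have := congrFun (congrFun h.mul_inv x) x
  rw [Matrix.mul_apply, one_apply_eq] at this
  simpa [mul_diagonal] using this

theorem mulVec_coeff (h : IsSpectralDecomposition L w Q μ) (f : ι → ℝ) :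
    Q *ᵥ coeff Q w f = f := by
  rw [coeff, mulVec_mulVec, h.mul_inv, one_mulVec]

theorem coeff_apply (f : ι → ℝ) (i : ι) : coeff Q w f i = ∑ x, Q x i * w x * f x := by
  simp [coeff, mulVec, dotProduct, mul_diagonal]

theorem apply_eq_sum (h : IsSpectralDecomposition L w Q μ) (f : ι → ℝ) (x : ι) :
    f x = ∑ i, Q x i * coeff Q w f i := by
  conv_lhs => rw [← h.mulVec_coeff f]
  rfl

theorem coeff_mulVec (h : IsSpectralDecomposition L w Q μ) (f : ι → ℝ) (i : ι) :
    coeff Q w ((diagonal (fun x => (w x)⁻¹) * L) *ᵥ f) i = μ i * coeff Q w f i := by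
  have : coeff Q w ((diagonal (fun x => (w x)⁻¹) * L) *ᵥ f) = diagonal μ *ᵥ coeff Q w f := by
    rw [coeff, coeff, mulVec_mulVec, mulVec_mulVec, h.eq, ← Matrix.mul_assoc, ← Matrix.mul_assoc,
      ← Matrix.mul_assoc, h.inv_mul, Matrix.one_mul, Matrix.mul_assoc]
  rw [this, mulVec_diagonal]

theorem sum_weight_mul (h : IsSpectralDecomposition L w Q μ) (f g : ι → ℝ) :
    ∑ x, w x * f x * g x = ∑ i, coeff Q w f i * coeff Q w g i := by
  have : ∀ x, w x * f x * g x = ∑ i, (Q x i * w x * f x) * coeff Q w g i := fun x => by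
    rw [h.apply_eq_sum g x, Finset.mul_sum]
    exact Finset.sum_congr rfl fun i _ => by ring
  simp_rw [this]
  rw [Finset.sum_comm]
  simp_rw [← Finset.sum_mul, ← coeff_apply]

theorem sum_weight_sq (h : IsSpectralDecomposition L w Q μ) (f : ι → ℝ) :
    ∑ x, w x * f x ^ 2 = ∑ i, coeff Q w f i ^ 2 := by
  simp_rw [pow_two, ← mul_assoc]
  exact h.sum_weight_mul f f

theorem form_eq (h : IsSpectralDecomposition L w Q μ) (hw : ∀ x, 0 < w x) (f : ι → ℝ) :
    f ⬝ᵥ L *ᵥ f = ∑ i, μ i * coeff Q w f i ^ 2 := by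
  have h1 : f ⬝ᵥ L *ᵥ f = ∑ x, w x * f x * ((diagonal (fun x => (w x)⁻¹) * L) *ᵥ f) x := by
    refine Finset.sum_congr rfl fun x _ => ?_
    rw [← mulVec_mulVec, mulVec_diagonal]
    field_simp [(hw x).ne']
  rw [h1, h.sum_weight_mul]
  exact Finset.sum_congr rfl fun i _ => by rw [h.coeff_mulVec]; ring

theorem hasEigenvalue (h : IsSpectralDecomposition L w Q μ) (i : ι) :
    Module.End.HasEigenvalue (Matrix.toLin' (diagonal (fun x => (w x)⁻¹) * L)) (μ i) := by
  refine Module.End.hasEigenvalue_of_hasEigenvector (x := Q *ᵥ Pi.single i 1) ⟨?_, ?_⟩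
  · rw [Module.End.mem_eigenspace_iff, Matrix.toLin'_apply, h.eq, mulVec_mulVec,
      Matrix.mul_assoc, h.inv_mul, Matrix.mul_one, ← mulVec_mulVec, ← mulVec_smul]
    congr 1
    funext j
    rw [mulVec_diagonal]
    by_cases hj : j = i
    · subst hj; simp
    · simp [hj]
  · intro h0
    have : (Qᵀ * diagonal w) *ᵥ (Q *ᵥ Pi.single i 1) = Pi.single i (1 : ℝ) := by
      rw [mulVec_mulVec, h.inv_mul, one_mulVec]
    rw [h0, mulVec_zero] at this
    have := congrFun this i
    simp at this

theorem le_of_form_lower_bound (h : IsSpectralDecomposition L w Q μ) (hw : ∀ x, 0 < w x) {c : ℝ}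
    (hc : ∀ f : ι → ℝ, c * ∑ x, w x * f x ^ 2 ≤ f ⬝ᵥ L *ᵥ f) (i : ι) : c ≤ μ i := by
  have h1 : coeff Q w (Q *ᵥ Pi.single i 1) = Pi.single i 1 := by
    rw [coeff, mulVec_mulVec, h.inv_mul, one_mulVec]
  have h2 := hc (Q *ᵥ Pi.single i 1)
  rw [h.form_eq hw, h.sum_weight_sq, h1] at h2
  simpa [Pi.single_apply] using h2

/-- Jensen's inequality for the heat semigroup. -/
theorem exp_neg_le_sum (h : IsSpectralDecomposition L w Q μ) (hw : ∀ x, 0 < w x) (f : ι → ℝ)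
    {R t : ℝ} (ht : 0 ≤ t) (hR : f ⬝ᵥ L *ᵥ f ≤ R * ∑ x, w x * f x ^ 2) :
    Real.exp (-(t * R)) * ∑ x, w x * f x ^ 2 ≤
      ∑ x, ∑ y, w x * f x * f y *
        NormedSpace.exp ((-t) • (diagonal (fun x => (w x)⁻¹) * L)) x y := by
  have h1 : ∑ x, ∑ y, w x * f x * f y *
        NormedSpace.exp ((-t) • (diagonal (fun x => (w x)⁻¹) * L)) x y =
      ∑ i, Real.exp (-(t * μ i)) * coeff Q w f i ^ 2 := by
    have : ∀ i, Real.exp (-(t * μ i)) * coeff Q w f i ^ 2 =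
        ∑ x, ∑ y, w x * f x * f y * (Q x i * Real.exp (-(t * μ i)) * (Q y i * w y)) := fun i => by
      rw [pow_two, coeff_apply, Finset.sum_mul_sum, Finset.mul_sum]
      refine Finset.sum_congr rfl fun x _ => ?_
      rw [Finset.mul_sum]
      exact Finset.sum_congr rfl fun y _ => by ring
    simp_rw [this, h.exp_apply, Finset.mul_sum]
    rw [Finset.sum_comm' (t' := Finset.univ) (s' := fun _ => Finset.univ) (by simp)]
    conv_rhs => rw [Finset.sum_comm]
    rw [Finset.sum_comm]
    exact Finset.sum_congr rfl fun x _ => Finset.sum_comm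
  rw [h1]
  rw [h.form_eq hw, h.sum_weight_sq] at hR
  rw [h.sum_weight_sq]
  -- The exponential lies above its tangent line at R. After weighting by the squared coefficients,
  -- the linear term has a favourable sign by `hR`.
  have h2 : ∀ i, Real.exp (-(t * R)) * (1 - t * (μ i - R)) ≤ Real.exp (-(t * μ i)) := fun i => by
    have : Real.exp (-(t * μ i)) = Real.exp (-(t * R)) * Real.exp (-(t * (μ i - R))) := by
      rw [← Real.exp_add]; ring_nf
    rw [this]
    have := Real.add_one_le_exp (-(t * (μ i - R)))
    exact mul_le_mul_of_nonneg_left (by linarith) (Real.exp_pos _).le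
  calc Real.exp (-(t * R)) * ∑ i, coeff Q w f i ^ 2
      ≤ Real.exp (-(t * R)) * (∑ i, coeff Q w f i ^ 2
          - t * (∑ i, μ i * coeff Q w f i ^ 2 - R * ∑ i, coeff Q w f i ^ 2)) := by
        refine mul_le_mul_of_nonneg_left ?_ (Real.exp_pos _).le
        nlinarith
    _ = ∑ i, Real.exp (-(t * R)) * (1 - t * (μ i - R)) * coeff Q w f i ^ 2 := by
        rw [Finset.mul_sum, ← Finset.sum_sub_distrib, Finset.mul_sum, ← Finset.sum_sub_distrib,
          Finset.mul_sum]
        exact Finset.sum_congr rfl fun i _ => by ring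
    _ ≤ _ := Finset.sum_le_sum fun i _ => mul_le_mul_of_nonneg_right (h2 i) (sq_nonneg _)

/-- Off-diagonal heat kernel entries are controlled by the diagonal ones at an earlier time. -/
theorem abs_exp_apply_le (h : IsSpectralDecomposition L w Q μ) (hw : ∀ x, 0 < w x) {c : ℝ}
    (hc : ∀ i, c ≤ μ i) {s t : ℝ} (ht : 0 ≤ t) (x y : ι) :
    |NormedSpace.exp ((-(s + t)) • (diagonal (fun x => (w x)⁻¹) * L)) x y| ≤
      Real.exp (-(t * c)) * (w y / 2) *
        (NormedSpace.exp ((-s) • (diagonal (fun x => (w x)⁻¹) * L)) x x / w x +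
          NormedSpace.exp ((-s) • (diagonal (fun x => (w x)⁻¹) * L)) y y / w y) := by
  have hdiag : ∀ x, NormedSpace.exp ((-s) • (diagonal (fun x => (w x)⁻¹) * L)) x x / w x =
      ∑ i, Real.exp (-(s * μ i)) * Q x i ^ 2 := fun x => by
    rw [h.exp_apply, Finset.sum_div]
    refine Finset.sum_congr rfl fun i _ => ?_
    field_simp [(hw x).ne']
  rw [hdiag, hdiag, h.exp_apply, ← Finset.sum_add_distrib, Finset.mul_sum]
  refine (Finset.abs_sum_le_sum_abs _ _).trans (Finset.sum_le_sum fun i _ => ?_)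
  rw [abs_mul, abs_mul, abs_mul, abs_of_pos (hw y), abs_of_pos (Real.exp_pos _)]
  have h1 : Real.exp (-((s + t) * μ i)) ≤ Real.exp (-(t * c)) * Real.exp (-(s * μ i)) := by
    rw [← Real.exp_add]
    exact Real.exp_le_exp.2 (by nlinarith [mul_le_mul_of_nonneg_left (hc i) ht])
  have h2 : |Q x i| * |Q y i| ≤ (Q x i ^ 2 + Q y i ^ 2) / 2 := by
    nlinarith [sq_nonneg (|Q x i| - |Q y i|), sq_abs (Q x i), sq_abs (Q y i)]
  calc |Q x i| * Real.exp (-((s + t) * μ i)) * (|Q y i| * w y)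
      = Real.exp (-((s + t) * μ i)) * (|Q x i| * |Q y i|) * w y := by ring
    _ ≤ (Real.exp (-(t * c)) * Real.exp (-(s * μ i))) * ((Q x i ^ 2 + Q y i ^ 2) / 2) * w y := by
        have := (hw y).le
        gcongr
    _ = _ := by ring

theorem exp_zero_apply_self (h : IsSpectralDecomposition L w Q μ) (x : ι) :
    NormedSpace.exp ((-(0 : ℝ)) • (diagonal (fun x => (w x)⁻¹) * L)) x x = 1 := by
  rw [h.exp_apply]
  simpa using h.sum_mul_self x

/-- A bound on the heat semigroup in `ℓ^∞` gives a bound on the resolvent at zero. -/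
theorem abs_le_of_sum_exp_le (h : IsSpectralDecomposition L w Q μ) (hμ : ∀ i, 0 < μ i)
    {C κ : ℝ} (hκ : 0 < κ) (x : ι)
    (hC : ∀ t : ℝ, 0 < t →
      ∑ y, |NormedSpace.exp ((-t) • (diagonal (fun x => (w x)⁻¹) * L)) x y| ≤
        C * Real.exp (-(κ * t)))
    (v : ι → ℝ) (hv : ∀ y, |((diagonal (fun x => (w x)⁻¹) * L) *ᵥ v) y| ≤ 1) :
    |v x| ≤ C / κ := by
  have key : ∀ v : ι → ℝ, (∀ y, |((diagonal (fun x => (w x)⁻¹) * L) *ᵥ v) y| ≤ 1) →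
      v x ≤ C / κ := by
    intro v hv
    -- F(t) = (e^{-tH}v)(x) − (C/κ)e^{-κt} has derivative −(e^{-tH}Hv)(x) + Ce^{-κt} ≥ 0 and tends
    -- to 0, so F(0) ≤ 0. This replaces integrating the semigroup over time.
    set F : ℝ → ℝ := fun t => ∑ i, Q x i * coeff Q w v i * Real.exp (-(t * μ i))
      - C / κ * Real.exp (-(κ * t)) with hF
    have hderiv : ∀ t, HasDerivAt F (∑ i, Q x i * coeff Q w v i *
        (Real.exp (-(t * μ i)) * -(1 * μ i)) - C / κ * (Real.exp (-(κ * t)) * -(κ * 1))) t := by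
      intro t
      refine HasDerivAt.sub (HasDerivAt.fun_sum fun i _ => ?_) ?_
      · exact ((((hasDerivAt_id t).mul_const (μ i)).neg).exp).const_mul _
      · exact ((((hasDerivAt_id t).const_mul κ).neg).exp).const_mul _
    have hmono : MonotoneOn F (Set.Ici 0) := by
      refine monotoneOn_of_deriv_nonneg (convex_Ici 0)
        (fun t _ => (hderiv t).continuousAt.continuousWithinAt)
        (fun t _ => (hderiv t).differentiableAt.differentiableWithinAt) fun t ht => ?_
      rw [interior_Ici] at ht
      rw [(hderiv t).deriv]
      have h1 : ∑ i, Q x i * coeff Q w v i * (Real.exp (-(t * μ i)) * -(1 * μ i)) =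
          -∑ y, NormedSpace.exp ((-t) • (diagonal (fun x => (w x)⁻¹) * L)) x y *
            ((diagonal (fun x => (w x)⁻¹) * L) *ᵥ v) y := by
        set g := (diagonal (fun x => (w x)⁻¹) * L) *ᵥ v with hg
        simp_rw [h.exp_apply, Finset.sum_mul]
        rw [Finset.sum_comm, ← Finset.sum_neg_distrib]
        refine Finset.sum_congr rfl fun i _ => ?_
        have : ∑ y, Q x i * Real.exp (-(t * μ i)) * (Q y i * w y) * g y =
            Q x i * Real.exp (-(t * μ i)) * coeff Q w g i := by
          rw [coeff_apply, Finset.mul_sum]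
          exact Finset.sum_congr rfl fun y _ => by ring
        rw [this, hg, h.coeff_mulVec]
        ring
      have h2 : ∑ y, NormedSpace.exp ((-t) • (diagonal (fun x => (w x)⁻¹) * L)) x y *
            ((diagonal (fun x => (w x)⁻¹) * L) *ᵥ v) y ≤ C * Real.exp (-(κ * t)) := by
        refine le_trans (Finset.sum_le_sum fun y _ => ?_) (hC t ht)
        refine (le_abs_self _).trans ?_
        rw [abs_mul]
        exact mul_le_of_le_one_right (abs_nonneg _) (hv y)
      rw [h1]
      have h3 : C / κ * (Real.exp (-(κ * t)) * -(κ * 1)) = -(C * Real.exp (-(κ * t))) := by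
        field_simp
      rw [h3]
      linarith
    have hlim : Filter.Tendsto F Filter.atTop (nhds (∑ i, Q x i * coeff Q w v i * 0
        - C / κ * 0)) := by
      refine Filter.Tendsto.sub (tendsto_finsetSum _ fun i _ => ?_) ?_
      · refine Filter.Tendsto.const_mul _ (Real.tendsto_exp_neg_atTop_nhds_zero.comp ?_)
        exact Filter.tendsto_id.atTop_mul_const (hμ i)
      · refine Filter.Tendsto.const_mul _ (Real.tendsto_exp_neg_atTop_nhds_zero.comp ?_)
        exact Filter.tendsto_id.const_mul_atTop hκ
    have h0 : F 0 ≤ ∑ i, Q x i * coeff Q w v i * 0 - C / κ * 0 := by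
      refine ge_of_tendsto hlim ?_
      filter_upwards [Filter.eventually_ge_atTop 0] with t ht
      exact hmono (Set.mem_Ici.2 le_rfl) ht ht
    simp only [hF, zero_mul, neg_zero, Real.exp_zero, mul_one, mul_zero,
      Finset.sum_const_zero, sub_zero, ← h.apply_eq_sum] at h0
    linarith
  rw [abs_le']
  refine ⟨key v hv, key (-v) fun y => ?_⟩
  rw [mulVec_neg, Pi.neg_apply, abs_neg]
  exact hv y

end IsSpectralDecomposition

/-! ### Variational bounds, minimum principle and landscape -/

section Eigenvalues

variable {L : Matrix ι ι ℝ} {w : ι → ℝ}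

theorem le_eigenvalue (hw : ∀ x, 0 < w x) {c : ℝ}
    (hc : ∀ f : ι → ℝ, c * ∑ x, w x * f x ^ 2 ≤ f ⬝ᵥ L *ᵥ f) {ν : ℝ}
    (hν : Module.End.HasEigenvalue (Matrix.toLin' (diagonal (fun x => (w x)⁻¹) * L)) ν) :
    c ≤ ν := by
  obtain ⟨φ, hφ, hφ0⟩ := hν.exists_hasEigenvector
  rw [Module.End.mem_eigenspace_iff, Matrix.toLin'_apply] at hφ
  have h1 : φ ⬝ᵥ L *ᵥ φ = ν * ∑ x, w x * φ x ^ 2 := by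
    rw [dotProduct, Finset.mul_sum]
    refine Finset.sum_congr rfl fun x _ => ?_
    have := congrFun hφ x
    rw [← mulVec_mulVec, mulVec_diagonal, Pi.smul_apply, smul_eq_mul] at this
    rw [inv_mul_eq_iff_eq_mul₀ (hw x).ne'] at this
    rw [this]; ring
  have h2 : 0 < ∑ x, w x * φ x ^ 2 := by
    obtain ⟨x, hx⟩ := Function.ne_iff.1 hφ0
    refine Finset.sum_pos' (fun y _ => mul_nonneg (hw y).le (sq_nonneg _))
      ⟨x, Finset.mem_univ _, mul_pos (hw x) ?_⟩
    exact sq_pos_of_ne_zero hx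
  have := hc φ
  rw [h1] at this
  exact le_of_mul_le_mul_right this h2

theorem sInf_eigenvalues_le (hL : L.IsSymm) (hw : ∀ x, 0 < w x) {c : ℝ}
    (hc : ∀ f : ι → ℝ, c * ∑ x, w x * f x ^ 2 ≤ f ⬝ᵥ L *ᵥ f) (f : ι → ℝ) :
    sInf {ν : ℝ | Module.End.HasEigenvalue
        (Matrix.toLin' (diagonal (fun x => (w x)⁻¹) * L)) ν} * ∑ x, w x * f x ^ 2
      ≤ f ⬝ᵥ L *ᵥ f := by
  obtain ⟨Q, μ, h⟩ := exists_isSpectralDecomposition hL hw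
  rw [h.form_eq hw, h.sum_weight_sq, Finset.mul_sum]
  refine Finset.sum_le_sum fun i _ => mul_le_mul_of_nonneg_right ?_ (sq_nonneg _)
  -- The lower bound `c` serves only to make the set of eigenvalues bounded below.
  exact csInf_le ⟨c, fun ν hν => le_eigenvalue hw hc hν⟩ (h.hasEigenvalue i)

theorem le_sInf_eigenvalues [Nonempty ι] (hL : L.IsSymm) (hw : ∀ x, 0 < w x) {c : ℝ}
    (hc : ∀ ν, Module.End.HasEigenvalue (Matrix.toLin' (diagonal (fun x => (w x)⁻¹) * L)) ν →
      c ≤ ν) :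
    c ≤ sInf {ν : ℝ | Module.End.HasEigenvalue
        (Matrix.toLin' (diagonal (fun x => (w x)⁻¹) * L)) ν} := by
  obtain ⟨Q, μ, h⟩ := exists_isSpectralDecomposition hL hw
  exact le_csInf ⟨_, h.hasEigenvalue (Classical.arbitrary ι)⟩ hc

/-- Minimum principle for positive definite matrices with nonpositive off-diagonal entries. -/
theorem nonneg_of_mulVec_nonneg (hoff : ∀ x y, x ≠ y → L x y ≤ 0)
    (hpos : ∀ f : ι → ℝ, f ≠ 0 → 0 < f ⬝ᵥ L *ᵥ f) {f : ι → ℝ} (hf : ∀ x, 0 ≤ (L *ᵥ f) x)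
    (x : ι) : 0 ≤ f x := by
  by_contra hx
  push Not at hx
  -- Test with the negative part g. The positive part f + g lives where g vanishes, so the
  -- off-diagonal signs give ⟨g, L(f+g)⟩ ≤ 0. With ⟨g, Lf⟩ ≥ 0 this forces ⟨g, Lg⟩ ≤ 0, against
  -- positivity.
  set g : ι → ℝ := fun x => max (-f x) 0 with hg
  have hg0 : g ≠ 0 := fun h => by
    have := congrFun h x
    simp only [hg, Pi.zero_apply, max_eq_right_iff] at this
    linarith
  have h1 : 0 ≤ g ⬝ᵥ L *ᵥ f :=
    Finset.sum_nonneg fun y _ => mul_nonneg (le_max_right _ _) (hf y)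
  have h2 : g ⬝ᵥ L *ᵥ (f + g) ≤ 0 := by
    simp only [dotProduct, mulVec, Finset.mul_sum]
    refine Finset.sum_nonpos fun y _ => Finset.sum_nonpos fun z _ => ?_
    have hgz : 0 ≤ (f + g) z := by
      have := le_max_left (-f z) 0
      simp only [hg, Pi.add_apply]; linarith
    by_cases hyz : y = z
    · subst hyz
      have : g y * (f + g) y = 0 := by
        simp only [hg, Pi.add_apply]
        rcases le_total (-f y) 0 with h | h
        · rw [max_eq_right h, zero_mul]
        · rw [max_eq_left h]; ring
      rw [mul_left_comm, this, mul_zero]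
    · exact mul_nonpos_of_nonneg_of_nonpos (le_max_right _ _)
        (mul_nonpos_of_nonpos_of_nonneg (hoff y z hyz) hgz)
  rw [mulVec_add, dotProduct_add] at h2
  linarith [hpos g hg0]

theorem mulVec_inv_mulVec (hw : ∀ x, 0 < w x) (hpos : ∀ f : ι → ℝ, f ≠ 0 → 0 < f ⬝ᵥ L *ᵥ f)
    (g : ι → ℝ) :
    (diagonal (fun x => (w x)⁻¹) * L) *ᵥ ((diagonal (fun x => (w x)⁻¹) * L)⁻¹ *ᵥ g) = g := by
  have hinj : Function.Injective (diagonal (fun x => (w x)⁻¹) * L).mulVec := by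
    rw [← Matrix.coe_mulVecLin, ← LinearMap.ker_eq_bot, LinearMap.ker_eq_bot']
    intro f hf
    by_contra h0
    have hLf : L *ᵥ f = 0 := by
      funext x
      have := congrFun hf x
      rw [Matrix.mulVecLin_apply, ← mulVec_mulVec, mulVec_diagonal] at this
      simpa [(hw x).ne'] using this
    have := hpos f h0
    rw [hLf, dotProduct_zero] at this
    exact lt_irrefl _ this
  have hunit := (Matrix.mulVec_injective_iff_isUnit).1 hinj
  rw [mulVec_mulVec, Matrix.mul_nonsing_inv _ ((Matrix.isUnit_iff_isUnit_det _).1 hunit),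
    one_mulVec]

/-- The landscape function dominates the inverse of every eigenvalue. -/
theorem one_le_eigenvalue_mul_norm [Nonempty ι] (hw : ∀ x, 0 < w x)
    (hoff : ∀ x y, x ≠ y → L x y ≤ 0) (hpos : ∀ f : ι → ℝ, f ≠ 0 → 0 < f ⬝ᵥ L *ᵥ f) {ν : ℝ}
    (hν0 : 0 < ν)
    (hν : Module.End.HasEigenvalue (Matrix.toLin' (diagonal (fun x => (w x)⁻¹) * L)) ν) :
    1 ≤ ν * ‖(diagonal (fun x => (w x)⁻¹) * L)⁻¹ *ᵥ (1 : ι → ℝ)‖ := by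
  obtain ⟨φ, hφ, hφ0⟩ := hν.exists_hasEigenvector
  rw [Module.End.mem_eigenspace_iff, Matrix.toLin'_apply] at hφ
  set u := (diagonal (fun x => (w x)⁻¹) * L)⁻¹ *ᵥ (1 : ι → ℝ) with hu
  have hHu : (diagonal (fun x => (w x)⁻¹) * L) *ᵥ u = 1 := mulVec_inv_mulVec hw hpos 1
  -- Comparison with the landscape: H maps ν‖φ‖u − ψ to ν(‖φ‖ − ψ) ≥ 0. It is applied to both φ and
  -- −φ.
  have key : ∀ ψ : ι → ℝ, (diagonal (fun x => (w x)⁻¹) * L) *ᵥ ψ = ν • ψ → (∀ x, ψ x ≤ ‖φ‖) →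
      ∀ x, ψ x ≤ ν * ‖φ‖ * u x := by
    intro ψ hψ hle x
    have : 0 ≤ ((ν * ‖φ‖) • u - ψ) x := by
      refine nonneg_of_mulVec_nonneg hoff hpos (fun y => ?_) x
      have h1 : ((diagonal (fun x => (w x)⁻¹) * L) *ᵥ ((ν * ‖φ‖) • u - ψ)) y =
          ν * (‖φ‖ - ψ y) := by
        rw [mulVec_sub, mulVec_smul, hHu, hψ]
        simp; ring
      rw [← mulVec_mulVec, mulVec_diagonal, inv_mul_eq_iff_eq_mul₀ (hw y).ne'] at h1
      rw [h1]
      exact mul_nonneg (hw y).le (mul_nonneg hν0.le (sub_nonneg.2 (hle y)))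
    simpa using this
  have hφpos : 0 < ‖φ‖ := norm_pos_iff.2 hφ0
  have h1 : ‖φ‖ ≤ ν * ‖φ‖ * ‖u‖ := by
    refine (pi_norm_le_iff_of_nonneg (by positivity)).2 fun x => ?_
    have hux : u x ≤ ‖u‖ := (le_abs_self _).trans (norm_le_pi_norm u x)
    have hmul : ν * ‖φ‖ * u x ≤ ν * ‖φ‖ * ‖u‖ := mul_le_mul_of_nonneg_left hux (by positivity)
    rw [Real.norm_eq_abs, abs_le']
    refine ⟨(key φ hφ (fun y => (le_abs_self _).trans (norm_le_pi_norm φ y)) x).trans hmul,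
      (key (-φ) ?_ (fun y => (neg_le_abs _).trans (norm_le_pi_norm φ y)) x).trans hmul⟩
    rw [mulVec_neg, hφ, smul_neg]
  have h2 : 1 * ‖φ‖ ≤ ν * ‖u‖ * ‖φ‖ := by linarith
  exact le_of_mul_le_mul_right h2 hφpos

end Eigenvalues

end WeightedMatrices

/-! ### Dirichlet matrices and their energy form -/

section DirichletForm

variable {V : Type*} [DecidableEq V]

/-- Extension by zero of a function on `A`. -/
def extendZero (A : Finset V) (f : A → ℝ) (v : V) : ℝ := if h : v ∈ A then f ⟨v, h⟩ else 0

theorem extendZero_coe (A : Finset V) (f : A → ℝ) (x : A) : extendZero A f x = f x := by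
  simp [extendZero]

theorem extendZero_of_notMem {A : Finset V} (f : A → ℝ) {v : V} (hv : v ∉ A) :
    extendZero A f v = 0 := by
  simp [extendZero, hv]

theorem extendZero_restrict {A : Finset V} {F : V → ℝ} (hF : ∀ v, v ∉ A → F v = 0) :
    extendZero A (fun x : A => F x) = F := by
  funext v
  by_cases hv : v ∈ A
  · simp [extendZero, hv]
  · rw [extendZero_of_notMem _ hv, hF v hv]

theorem dirichletRestriction_mulVec (H : (V → ℝ) →ₗ[ℝ] (V → ℝ)) (A : Finset V) (f : A → ℝ)
    (x : A) : (dirichletRestriction H A *ᵥ f) x = H (extendZero A f) x := by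
  have h : extendZero A f = ∑ y : A, f y • Pi.single (y : V) (1 : ℝ) := by
    funext v
    rw [Finset.sum_apply]
    by_cases hv : v ∈ A
    · rw [Finset.sum_eq_single ⟨v, hv⟩]
      · simp [extendZero, hv]
      · intro b _ hb
        have : v ≠ b := fun h => hb (Subtype.ext h.symm)
        simp [this]
      · simp
    · rw [extendZero_of_notMem _ hv, eq_comm]
      refine Finset.sum_eq_zero fun b _ => ?_
      have : v ≠ b := fun h => hv (h ▸ b.2)
      simp [this]
  rw [h, map_sum, Finset.sum_apply, mulVec, dotProduct]
  refine Finset.sum_congr rfl fun y _ => ?_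
  rw [map_smul, Pi.smul_apply, smul_eq_mul, mul_comm]
  rfl

variable (Γ : SimpleGraph V) [Γ.LocallyFinite] (A : Finset V)

theorem dirichletRestriction_comb_apply (x y : A) :
    dirichletRestriction (negCombLaplacian Γ) A x y =
      (if x = y then (Γ.degree x : ℝ) else 0) -
        if (y : V) ∈ Γ.neighborFinset x then 1 else 0 := by
  change ∑ v ∈ Γ.neighborFinset x,
    ((Pi.single (y : V) (1 : ℝ) : V → ℝ) x - (Pi.single (y : V) (1 : ℝ) : V → ℝ) v) = _
  rw [Finset.sum_sub_distrib, Finset.sum_const, SimpleGraph.card_neighborFinset_eq_degree]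
  congr 1
  · by_cases h : x = y
    · simp [h]
    · have : (x : V) ≠ y := fun h' => h (Subtype.ext h')
      simp [h, this]
  · exact Finset.sum_pi_single' _ _ _

theorem dirichletRestriction_comb_isSymm :
    (dirichletRestriction (negCombLaplacian Γ) A).IsSymm := by
  ext x y
  rw [transpose_apply, dirichletRestriction_comb_apply, dirichletRestriction_comb_apply]
  have h : (x : V) ∈ Γ.neighborFinset y ↔ (y : V) ∈ Γ.neighborFinset x := by
    rw [SimpleGraph.mem_neighborFinset, SimpleGraph.mem_neighborFinset, SimpleGraph.adj_comm]
  congr 1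
  · by_cases hxy : x = y
    · rw [hxy]
    · rw [if_neg hxy, if_neg (Ne.symm hxy)]
  · exact if_congr h rfl rfl

theorem dirichletRestriction_comb_nonpos (x y : A) (h : x ≠ y) :
    dirichletRestriction (negCombLaplacian Γ) A x y ≤ 0 := by
  rw [dirichletRestriction_comb_apply, if_neg h]
  split_ifs <;> norm_num

theorem dirichletRestriction_prob :
    dirichletRestriction (negProbLaplacian Γ) A =
      diagonal (fun x : A => (Γ.degree (x : V) : ℝ)⁻¹) *
        dirichletRestriction (negCombLaplacian Γ) A := by
  ext x y
  rw [diagonal_mul]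
  change 1 / (Γ.degree (x : V) : ℝ) * _ = _
  rw [one_div]
  rfl

/-- The case of weight one, which lets the weighted lemmas apply to the combinatorial operator. -/
theorem dirichletRestriction_comb :
    dirichletRestriction (negCombLaplacian Γ) A =
      diagonal (fun _ : A => (1 : ℝ)⁻¹) * dirichletRestriction (negCombLaplacian Γ) A := by
  simp

theorem form_comb_eq (f : A → ℝ) :
    f ⬝ᵥ dirichletRestriction (negCombLaplacian Γ) A *ᵥ f =
      ∑ x ∈ A, extendZero A f x *
        ∑ y ∈ Γ.neighborFinset x, (extendZero A f x - extendZero A f y) := by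
  rw [← Finset.sum_coe_sort A, dotProduct]
  refine Finset.sum_congr rfl fun x _ => ?_
  rw [dirichletRestriction_mulVec, extendZero_coe]
  simp only [negCombLaplacian, LinearMap.coe_mk, AddHom.coe_mk, extendZero_coe]

/-- The Dirichlet form is comparable with the sum of squared differences over directed edges
starting in the support. -/
theorem sum_sq_sub_bounds {S : Finset V} {F : V → ℝ} (hF : ∀ v, v ∉ S → F v = 0) :
    ∑ x ∈ S, ∑ y ∈ Γ.neighborFinset x, (F x - F y) ^ 2 ≤
        2 * ∑ x ∈ S, F x * ∑ y ∈ Γ.neighborFinset x, (F x - F y) ∧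
      ∑ x ∈ S, F x * ∑ y ∈ Γ.neighborFinset x, (F x - F y) ≤
        ∑ x ∈ S, ∑ y ∈ Γ.neighborFinset x, (F x - F y) ^ 2 := by
  -- The directed energy is twice the form minus D. In D the edges inside S cancel by symmetry; each
  -- edge leaving S contributes F(x)² = (F x − F y)², so D lies between 0 and the directed energy.
  set D := ∑ x ∈ S, ∑ y ∈ Γ.neighborFinset x, (F x ^ 2 - F y ^ 2) with hD
  have h1 : ∑ x ∈ S, ∑ y ∈ Γ.neighborFinset x, (F x - F y) ^ 2 =
      2 * ∑ x ∈ S, F x * ∑ y ∈ Γ.neighborFinset x, (F x - F y) - D := by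
    rw [hD, Finset.mul_sum, ← Finset.sum_sub_distrib]
    refine Finset.sum_congr rfl fun x _ => ?_
    rw [Finset.mul_sum, Finset.mul_sum, ← Finset.sum_sub_distrib]
    exact Finset.sum_congr rfl fun y _ => by ring
  have hswap : ∑ x ∈ S, ∑ y ∈ Γ.neighborFinset x with y ∈ S, F y ^ 2 =
      ∑ x ∈ S, ∑ y ∈ Γ.neighborFinset x with y ∈ S, F x ^ 2 := by
    refine Finset.sum_comm' fun x y => ?_
    simp only [Finset.mem_filter, SimpleGraph.mem_neighborFinset]
    constructor
    · rintro ⟨h1, h2, h3⟩; exact ⟨⟨h2.symm, h1⟩, h3⟩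
    · rintro ⟨⟨h2, h1⟩, h3⟩; exact ⟨h1, h2.symm, h3⟩
  have h2 : D = ∑ x ∈ S, ∑ y ∈ Γ.neighborFinset x with y ∉ S, F x ^ 2 := by
    have hx : ∀ x, ∑ y ∈ Γ.neighborFinset x, (F x ^ 2 - F y ^ 2) =
        ∑ y ∈ Γ.neighborFinset x with y ∉ S, F x ^ 2 +
          (∑ y ∈ Γ.neighborFinset x with y ∈ S, F x ^ 2 -
            ∑ y ∈ Γ.neighborFinset x with y ∈ S, F y ^ 2) := fun x => by
      rw [← Finset.sum_filter_add_sum_filter_not (Γ.neighborFinset x) (· ∈ S),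
        Finset.sum_sub_distrib, add_comm]
      congr 1
      refine Finset.sum_congr rfl fun y hy => ?_
      rw [hF y (Finset.mem_filter.1 hy).2]; ring
    rw [hD]
    simp_rw [hx]
    rw [Finset.sum_add_distrib, Finset.sum_sub_distrib, hswap, sub_self, add_zero]
  have h3 : 0 ≤ D := by
    rw [h2]
    exact Finset.sum_nonneg fun x _ => Finset.sum_nonneg fun y _ => sq_nonneg _
  have h4 : D ≤ ∑ x ∈ S, ∑ y ∈ Γ.neighborFinset x, (F x - F y) ^ 2 := by
    rw [h2]
    refine Finset.sum_le_sum fun x _ => ?_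
    calc ∑ y ∈ Γ.neighborFinset x with y ∉ S, F x ^ 2
        = ∑ y ∈ Γ.neighborFinset x with y ∉ S, (F x - F y) ^ 2 :=
          Finset.sum_congr rfl fun y hy => by rw [hF y (Finset.mem_filter.1 hy).2, sub_zero]
      _ ≤ _ := Finset.sum_le_sum_of_subset_of_nonneg (Finset.filter_subset _ _)
          fun y _ _ => sq_nonneg _
  constructor <;> linarith

end DirichletForm

/-! ### Distance to the boundary, spectral gap and cut-offs -/

section Distance

variable {V : Type*} {Γ : SimpleGraph V}

/-- `Set.ncard` is 0 on infinite sets, so `SphereGrowth` controls finite subsets of spheres only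
once the spheres are known to be finite. -/
theorem finite_dist_le [Γ.LocallyFinite] (hconn : Γ.Connected) (x : V) (n : ℕ) :
    {y | Γ.dist x y ≤ n}.Finite := by
  induction n with
  | zero =>
    refine (Set.finite_singleton x).subset fun y hy => ?_
    have : Γ.dist x y = 0 := Nat.le_zero.1 hy
    exact ((hconn.dist_eq_zero_iff).1 this).symm
  | succ n ih =>
    refine (ih.union (ih.biUnion fun v _ => (Γ.neighborFinset v).finite_toSet)).subset ?_
    intro y hy
    rcases Nat.lt_or_ge (Γ.dist x y) (n + 1) with h | h
    · exact Or.inl (Nat.lt_succ_iff.1 h)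
    · right
      obtain ⟨p, hp⟩ := hconn.exists_walk_length_eq_dist y x
      cases p with
      | nil => simp at h
      | @cons _ v _ hadj q =>
        rw [SimpleGraph.Walk.length_cons, SimpleGraph.dist_comm] at hp
        refine Set.mem_biUnion (x := v) ?_ ?_
        · have h1 : Γ.dist x v ≤ q.length := by
            rw [SimpleGraph.dist_comm]; exact SimpleGraph.dist_le q
          have h2 : Γ.dist x y ≤ n + 1 := hy
          change Γ.dist x v ≤ n
          omega
        · simpa using hadj.symm

theorem dist_le_dist_add_one (hconn : Γ.Connected) (x : V) {y v : V} (h : Γ.Adj y v) :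
    Γ.dist x v ≤ Γ.dist x y + 1 := by
  have := hconn.dist_triangle (u := x) (v := y) (w := v)
  rwa [SimpleGraph.dist_eq_one_iff_adj.2 h] at this

/-- A geodesic from x to v must leave A, and its first vertex after an exiting edge lies in the
boundary. -/
theorem exists_extBoundary_dist_le (hconn : Γ.Connected) {A : Finset V} {x v : V} (hx : x ∈ A)
    (hv : v ∉ A) : ∃ y ∈ extBoundary Γ A, Γ.dist x y ≤ Γ.dist x v := by
  classical
  obtain ⟨p, hp⟩ := hconn.exists_walk_length_eq_dist x v
  obtain ⟨d, hd, h1, h2⟩ := p.exists_boundary_dart (A : Set V) hx hv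
  refine ⟨d.snd, ⟨h2, d.fst, h1, d.adj⟩, ?_⟩
  have hs : d.snd ∈ p.support := p.dart_snd_mem_support_of_mem_darts hd
  rw [← hp]
  exact (SimpleGraph.dist_le (p.takeUntil _ hs)).trans (p.length_takeUntil_le_length hs)

theorem distToBoundary_le (hconn : Γ.Connected) {A : Finset V} {x v : V} (hx : x ∈ A)
    (hv : v ∉ A) : distToBoundary Γ A x ≤ Γ.dist x v := by
  obtain ⟨y, hy, hle⟩ := exists_extBoundary_dist_le hconn hx hv
  exact (Nat.sInf_le (Set.mem_image_of_mem _ hy)).trans hle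

theorem one_le_distToBoundary [Infinite V] (hconn : Γ.Connected) {A : Finset V} {x : V}
    (hx : x ∈ A) : 1 ≤ distToBoundary Γ A x := by
  -- The infimum of the empty set is 0 in ℕ, so the boundary must first be shown nonempty.
  obtain ⟨v, hv⟩ := Infinite.exists_notMem_finset A
  obtain ⟨y, hy, -⟩ := exists_extBoundary_dist_le hconn hx hv
  obtain ⟨b, hb, hbx⟩ := Nat.sInf_mem (s := (fun y => Γ.dist x y) '' extBoundary Γ A)
    ⟨_, y, hy, rfl⟩
  have hbx : Γ.dist x b = distToBoundary Γ A x := hbx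
  rw [← hbx]
  exact hconn.pos_dist_of_ne fun h => hb.1 (h ▸ hx)

theorem one_le_inradius [Infinite V] (hconn : Γ.Connected) {A : Finset V} (hA : A.Nonempty) :
    1 ≤ inradius Γ A := by
  obtain ⟨x, hx⟩ := hA
  exact (one_le_distToBoundary hconn hx).trans (Finset.le_sup (f := distToBoundary Γ A) hx)

variable [Γ.LocallyFinite]

theorem one_le_degree [Infinite V] (hconn : Γ.Connected) (x : V) : (1 : ℝ) ≤ Γ.degree x := by
  exact_mod_cast hconn.preconnected.degree_pos_of_nontrivial x

/-- Sums of radial functions under the sphere growth condition. -/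
theorem sum_radial_le (hconn : Γ.Connected) {CU z : ℝ} (hvol : SphereGrowth Γ CU z)
    (S : Finset V) (x : V) {g : ℕ → ℝ} (hg : ∀ r, 0 ≤ g r) {N : ℕ}
    (hN : ∀ y ∈ S, Γ.dist x y ≤ N) (hx : x ∉ S) :
    ∑ y ∈ S, g (Γ.dist x y) ≤ ∑ r ∈ Finset.Icc 1 N, CU * (r : ℝ) ^ (z - 1) * g r := by
  rw [← Finset.sum_fiberwise_of_maps_to (s := S) (t := Finset.Icc 1 N) (g := Γ.dist x)
    fun y hy => Finset.mem_Icc.2 ⟨hconn.pos_dist_of_ne fun h => hx (h ▸ hy), hN y hy⟩]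
  refine Finset.sum_le_sum fun r hr => ?_
  rw [Finset.sum_congr rfl fun y hy => by rw [(Finset.mem_filter.1 hy).2], Finset.sum_const,
    nsmul_eq_mul]
  refine mul_le_mul_of_nonneg_right (le_trans ?_ (hvol x r (Finset.mem_Icc.1 hr).1)) (hg r)
  rw [← Set.ncard_coe_finset]
  refine Nat.cast_le.2 (Set.ncard_le_ncard ?_ ?_)
  · intro y hy
    exact (Finset.mem_filter.1 (Finset.mem_coe.1 hy)).2
  · exact (finite_dist_le hconn x r).subset fun y hy => le_of_eq hy

variable [DecidableEq V]

/-- The Hardy inequality implies a spectral gap of order `ρ_A⁻²`. -/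
theorem spectral_gap_of_hardy [Infinite V] (hconn : Γ.Connected) {A : Finset V}
    {CA : ℝ} (hCA : 0 < CA) (hH : HardyInequality Γ A CA) (f : A → ℝ) :
    (2 * CA)⁻¹ * ((inradius Γ A : ℝ) ^ 2)⁻¹ * ∑ x : A, (Γ.degree (x : V) : ℝ) * f x ^ 2 ≤
      f ⬝ᵥ dirichletRestriction (negCombLaplacian Γ) A *ᵥ f := by
  set F := extendZero A f with hF
  have hF0 : ∀ v, v ∉ A → F v = 0 := fun v hv => extendZero_of_notMem f hv
  have h1 := hH F hF0
  -- The directed energy in Hardy's inequality is at most twice the form, whence the 2 in `(2 *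
  -- CA)⁻¹`.
  have h2 := (sum_sq_sub_bounds Γ hF0).1
  rw [form_comb_eq, ← hF]
  have h3 : ∑ x ∈ A, ∑ y ∈ Γ.neighborFinset x, |F y - F x| ^ 2 =
      ∑ x ∈ A, ∑ y ∈ Γ.neighborFinset x, (F x - F y) ^ 2 :=
    Finset.sum_congr rfl fun x _ => Finset.sum_congr rfl fun y _ => by rw [sq_abs]; ring
  rw [h3] at h1
  have h4 : ((inradius Γ A : ℝ) ^ 2)⁻¹ * ∑ x : A, (Γ.degree (x : V) : ℝ) * f x ^ 2 ≤
      ∑ x ∈ A, (Γ.degree x : ℝ) * F x ^ 2 / (distToBoundary Γ A x : ℝ) ^ 2 := by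
    rw [← Finset.sum_coe_sort A, Finset.mul_sum]
    refine Finset.sum_le_sum fun x _ => ?_
    rw [hF, extendZero_coe, inv_mul_eq_div]
    have hd : (1 : ℝ) ≤ distToBoundary Γ A x := by
      exact_mod_cast one_le_distToBoundary hconn x.2
    have hr : (distToBoundary Γ A x : ℝ) ≤ inradius Γ A := by
      exact_mod_cast Finset.le_sup (f := distToBoundary Γ A) x.2
    have : (0 : ℝ) < distToBoundary Γ A x := by linarith
    gcongr
  rw [mul_assoc, inv_mul_le_iff₀ (by positivity)]
  nlinarith

variable (Γ) in
/-- The part in `A` of the open ball around `x`. -/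
noncomputable def ballIn (A : Finset V) (x : V) (r : ℕ) : Finset V := {y ∈ A | Γ.dist x y < r}

/-- Cut-off functions on balls inside `A`. -/
theorem exists_cutoff (hconn : Γ.Connected) {M : ℕ} (hM : ∀ x, Γ.degree x ≤ M) {A : Finset V}
    {x₀ : V} (hx₀ : x₀ ∈ A) {r s : ℕ} (hr : r ≤ distToBoundary Γ A x₀) (hs : 2 * s ≤ r + 1) :
    ∃ f : A → ℝ, (∀ x : A, (x : V) ∉ ballIn Γ A x₀ r → f x = 0) ∧
      f ⬝ᵥ dirichletRestriction (negCombLaplacian Γ) A *ᵥ f ≤ M * (ballIn Γ A x₀ r).card ∧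
      ((r : ℝ) / 2) ^ 2 * (ballIn Γ A x₀ s).card ≤ ∑ x, f x ^ 2 := by
  -- Truncated subtraction makes this the tent of height r: 1-Lipschitz and zero outside the ball,
  -- which stays in A since r ≤ δ(x₀).
  set F : V → ℝ := fun v => ((r - Γ.dist x₀ v : ℕ) : ℝ) with hF
  have hball : ∀ v, v ∉ ballIn Γ A x₀ r → F v = 0 := by
    intro v hv
    have : r ≤ Γ.dist x₀ v := by
      by_contra h
      push Not at h
      refine hv (Finset.mem_filter.2 ⟨?_, h⟩)
      by_contra hvA
      have := distToBoundary_le hconn hx₀ hvA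
      omega
    simp [hF, Nat.sub_eq_zero_of_le this]
  have hsub : ballIn Γ A x₀ r ⊆ A := Finset.filter_subset _ _
  have hA : ∀ v, v ∉ A → F v = 0 := fun v hv => hball v fun h => hv (hsub h)
  refine ⟨fun x => F x, fun x hx => hball x hx, ?_, ?_⟩
  · rw [form_comb_eq, extendZero_restrict hA,
      ← Finset.sum_subset hsub fun v _ hv => by rw [hball v hv, zero_mul]]
    refine (sum_sq_sub_bounds Γ hball).2.trans ?_
    rw [mul_comm, ← nsmul_eq_mul]
    refine Finset.sum_le_card_nsmul _ _ _ fun x _ => ?_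
    refine (Finset.sum_le_card_nsmul _ _ 1 fun y hy => ?_).trans ?_
    · have hadj : Γ.Adj x y := by simpa using hy
      have h1 := dist_le_dist_add_one hconn x₀ hadj
      have h2 := dist_le_dist_add_one hconn x₀ hadj.symm
      have h3 : r - Γ.dist x₀ x ≤ (r - Γ.dist x₀ y) + 1 := by omega
      have h4 : r - Γ.dist x₀ y ≤ (r - Γ.dist x₀ x) + 1 := by omega
      have h3' : F x ≤ F y + 1 := by simp only [hF]; exact_mod_cast h3
      have h4' : F y ≤ F x + 1 := by simp only [hF]; exact_mod_cast h4
      rw [sq_le_one_iff_abs_le_one, abs_le]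
      constructor <;> linarith
    · rw [SimpleGraph.card_neighborFinset_eq_degree, nsmul_one]
      exact_mod_cast hM x
  · rw [Finset.sum_coe_sort A fun v => F v ^ 2]
    have hsub' : ballIn Γ A x₀ s ⊆ A := Finset.filter_subset _ _
    refine le_trans ?_ (Finset.sum_le_sum_of_subset_of_nonneg hsub' fun v _ _ => sq_nonneg _)
    rw [mul_comm, ← nsmul_eq_mul]
    refine Finset.card_nsmul_le_sum _ _ _ fun v hv => ?_
    -- Because the ball is open, 2s ≤ r + 1 suffices for F ≥ r/2 on it; this admits r = s = 1.
    have h1 : Γ.dist x₀ v < s := (Finset.mem_filter.1 hv).2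
    have h2 : r ≤ 2 * (r - Γ.dist x₀ v) := by omega
    have h2' : (r : ℝ) ≤ 2 * F v := by simp only [hF]; exact_mod_cast h2
    have : (0 : ℝ) ≤ r := Nat.cast_nonneg r
    gcongr
    linarith

theorem card_ballIn_le (hconn : Γ.Connected) {CU z : ℝ} (hCU : 0 < CU) (hz : 1 ≤ z)
    (hvol : SphereGrowth Γ CU z) (A : Finset V) (x : V) {r : ℕ} (hr : 1 ≤ r) :
    ((ballIn Γ A x r).card : ℝ) ≤ (1 + CU) * (r : ℝ) ^ z := by
  have h1 := sum_radial_le hconn hvol ((ballIn Γ A x r).erase x) x (g := fun _ => 1)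
    (fun _ => zero_le_one) (N := r)
    (fun y hy => (Finset.mem_filter.1 (Finset.mem_of_mem_erase hy)).2.le)
    (Finset.notMem_erase _ _)
  have hr' : (1 : ℝ) ≤ r := by exact_mod_cast hr
  have h2 : ∑ j ∈ Finset.Icc 1 r, CU * (j : ℝ) ^ (z - 1) * 1 ≤ CU * (r : ℝ) ^ z := by
    have : CU * (r : ℝ) ^ z = r • (CU * (r : ℝ) ^ (z - 1)) := by
      rw [nsmul_eq_mul, Real.rpow_sub_one (by linarith)]
      field_simp
    rw [this]
    have hb := Finset.sum_le_card_nsmul (Finset.Icc 1 r)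
      (fun j : ℕ => CU * (j : ℝ) ^ (z - 1) * 1) (CU * (r : ℝ) ^ (z - 1)) fun j hj => by
        rw [mul_one]
        have : (j : ℝ) ≤ r := by exact_mod_cast (Finset.mem_Icc.1 hj).2
        have hz' : 0 ≤ z - 1 := by linarith
        gcongr
    simpa using hb
  have h3 : (ballIn Γ A x r).card ≤ ((ballIn Γ A x r).erase x).card + 1 := by
    have := Finset.pred_card_le_card_erase (s := ballIn Γ A x r) (a := x)
    omega
  have h3' : ((ballIn Γ A x r).card : ℝ) ≤ ((ballIn Γ A x r).erase x).card + 1 := by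
    exact_mod_cast h3
  have h4 : (1 : ℝ) ≤ (r : ℝ) ^ z := Real.one_le_rpow hr' (by linarith)
  simp only [Finset.sum_const, nsmul_one] at h1
  linarith

end Distance

/-! ### Faber–Krahn inequality, volume bounds and trial functions -/

section FaberKrahn

theorem self_mem_ballIn {V : Type*} {Γ : SimpleGraph V} {A : Finset V} {x : V} (hx : x ∈ A) {r : ℕ} (hr : 0 < r) :
    x ∈ ballIn Γ A x r :=
  Finset.mem_filter.2 ⟨hx, by rwa [SimpleGraph.dist_self]⟩

variable {V : Type*} [DecidableEq V] {Γ : SimpleGraph V} [Γ.LocallyFinite]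

theorem semigroupKernel_prob (A : Finset V) (t : ℝ) (x y : A) :
    semigroupKernel (negProbLaplacian Γ) A t x y =
      NormedSpace.exp ((-t) • (diagonal (fun x : A => (Γ.degree (x : V) : ℝ)⁻¹) *
        dirichletRestriction (negCombLaplacian Γ) A)) x y := by
  rw [semigroupKernel, dirichletRestriction_prob]

/-- Extra time t is traded for the factor e^{-tc}. The factor M appears because the kernel is
symmetric only after division by the degree. The cases s = 0 (pure decay) and t = 0, c = 0
(off-diagonal from diagonal) are both used. -/
theorem abs_semigroupKernel_le [Infinite V] (hconn : Γ.Connected) {M : ℕ}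
    (hM : ∀ x, Γ.degree x ≤ M) {A : Finset V} {c : ℝ}
    (hgap : ∀ f : A → ℝ, c * ∑ x : A, (Γ.degree (x : V) : ℝ) * f x ^ 2 ≤
      f ⬝ᵥ dirichletRestriction (negCombLaplacian Γ) A *ᵥ f)
    {K s : ℝ} (hK : ∀ x : A, |semigroupKernel (negProbLaplacian Γ) A s x x| ≤ K) {t : ℝ}
    (ht : 0 ≤ t) (x y : A) :
    |semigroupKernel (negProbLaplacian Γ) A (s + t) x y| ≤ Real.exp (-(t * c)) * (M * K) := by
  have hw : ∀ x : A, (0 : ℝ) < Γ.degree (x : V) := fun x =>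
    zero_lt_one.trans_le (one_le_degree hconn _)
  obtain ⟨Q, μ, h⟩ := exists_isSpectralDecomposition (dirichletRestriction_comb_isSymm Γ A) hw
  have h1 := h.abs_exp_apply_le hw (h.le_of_form_lower_bound hw hgap) (s := s) ht x y
  simp_rw [semigroupKernel_prob] at hK ⊢
  refine h1.trans ?_
  have h2 : ∀ x : A, NormedSpace.exp ((-s) • (diagonal (fun x : A => (Γ.degree (x : V) : ℝ)⁻¹) *
      dirichletRestriction (negCombLaplacian Γ) A)) x x / (Γ.degree (x : V) : ℝ) ≤ K := fun x => by
    have hK0 : 0 ≤ K := (abs_nonneg _).trans (hK x)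
    exact (div_le_div_of_nonneg_right ((le_abs_self _).trans (hK x)) (hw x).le).trans
      (div_le_self hK0 (one_le_degree hconn _))
  have hK0 : 0 ≤ K := (abs_nonneg _).trans (hK x)
  have hMy : (Γ.degree (y : V) : ℝ) ≤ M := by exact_mod_cast hM y
  rw [mul_assoc]
  refine mul_le_mul_of_nonneg_left ?_ (Real.exp_pos _).le
  calc _ ≤ (Γ.degree (y : V) : ℝ) / 2 * (K + K) :=
        mul_le_mul_of_nonneg_left (add_le_add (h2 x) (h2 y)) (half_pos (hw y)).le
    _ = Γ.degree (y : V) * K := by ring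
    _ ≤ _ := mul_le_mul_of_nonneg_right hMy hK0

/-- A Faber–Krahn inequality derived from on-diagonal heat kernel bounds. -/
theorem faberKrahn [Infinite V] (hconn : Γ.Connected) {M : ℕ} (hM : ∀ x, Γ.degree x ≤ M)
    {z k₅ : ℝ} (hz : 1 ≤ z) (hk₅ : 0 < k₅) {A : Finset V}
    (hdiag : ∀ t : ℝ, 0 < t → ∀ x : A,
      |semigroupKernel (negProbLaplacian Γ) A t x x| ≤ k₅ * t ^ (-z / 2))
    (hpos : ∀ f : A → ℝ, 0 ≤ f ⬝ᵥ dirichletRestriction (negCombLaplacian Γ) A *ᵥ f)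
    {S : Finset V} (hS : S.Nonempty) {f : A → ℝ} (hf : ∀ x : A, (x : V) ∉ S → f x = 0)
    (hf0 : 0 < ∑ x, f x ^ 2) {R : ℝ} (hR0 : 0 ≤ R)
    (hR : f ⬝ᵥ dirichletRestriction (negCombLaplacian Γ) A *ᵥ f ≤ R * ∑ x, f x ^ 2) :
    1 ≤ (Real.exp 1 * (M ^ 2 * k₅) * S.card) ^ (2 / z) * R := by
  have hw1 : ∀ x : A, (1 : ℝ) ≤ Γ.degree (x : V) := fun x => one_le_degree hconn _
  have hw : ∀ x : A, (0 : ℝ) < Γ.degree (x : V) := fun x => zero_lt_one.trans_le (hw1 x)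
  have hwf : ∑ x, f x ^ 2 ≤ ∑ x : A, (Γ.degree (x : V) : ℝ) * f x ^ 2 :=
    Finset.sum_le_sum fun x _ => le_mul_of_one_le_left (sq_nonneg _) (hw1 x)
  have hMx : ∀ x : V, (Γ.degree x : ℝ) ≤ M := fun x => by exact_mod_cast hM x
  have hMpos : (0 : ℝ) < M := by
    obtain ⟨x, -⟩ := hS
    exact zero_lt_one.trans_le ((one_le_degree hconn x).trans (hMx x))
  have hScard : (0 : ℝ) < S.card := by exact_mod_cast hS.card_pos
  obtain ⟨Q, μ, h⟩ := exists_isSpectralDecomposition (dirichletRestriction_comb_isSymm Γ A) hw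
  have hcs : (∑ x, |f x|) ^ 2 ≤ S.card * ∑ x, f x ^ 2 := by
    have h1 : ∑ x, |f x| = ∑ x ∈ Finset.univ.filter (fun x : A => (x : V) ∈ S), |f x| := by
      rw [Finset.sum_filter_of_ne]
      intro x _ hx
      by_contra hxS
      exact hx (by rw [hf x hxS, abs_zero])
    have h2 : (Finset.univ.filter fun x : A => (x : V) ∈ S).card ≤ S.card :=
      Finset.card_le_card_of_injOn (fun x : A => (x : V))
        (fun x hx => (Finset.mem_filter.1 hx).2) (fun x _ y _ hxy => Subtype.ext hxy)
    rw [h1]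
    refine sq_sum_le_card_mul_sum_sq.trans ?_
    refine mul_le_mul (by exact_mod_cast h2) ?_
      (Finset.sum_nonneg fun _ _ => sq_nonneg _) hScard.le
    simp_rw [sq_abs]
    exact Finset.sum_le_sum_of_subset_of_nonneg (Finset.filter_subset _ _)
      fun _ _ _ => sq_nonneg _
  -- Jensen bounds ⟨f, e^{-tH}f⟩ from below; the kernel bound and Cauchy–Schwarz on S bound it from
  -- above.
  have key : ∀ t : ℝ, 0 < t → Real.exp (-(t * R)) ≤ M ^ 2 * k₅ * S.card * t ^ (-z / 2) := by
    intro t ht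
    have hK0 : 0 ≤ k₅ * t ^ (-z / 2) := by positivity
    have hR' : f ⬝ᵥ dirichletRestriction (negCombLaplacian Γ) A *ᵥ f ≤
        R * ∑ x : A, (Γ.degree (x : V) : ℝ) * f x ^ 2 :=
      hR.trans (mul_le_mul_of_nonneg_left hwf hR0)
    have h1 := h.exp_neg_le_sum hw f ht.le hR'
    have hoff : ∀ x y : A, |semigroupKernel (negProbLaplacian Γ) A t x y| ≤
        M * (k₅ * t ^ (-z / 2)) := fun x y => by
      have := abs_semigroupKernel_le hconn hM (c := 0) (fun f => by simpa using hpos f)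
        (hdiag t ht) le_rfl x y
      simpa using this
    simp_rw [← semigroupKernel_prob] at h1
    have h2 : ∑ x : A, ∑ y : A, (Γ.degree (x : V) : ℝ) * f x * f y *
        semigroupKernel (negProbLaplacian Γ) A t x y ≤
        M * (M * (k₅ * t ^ (-z / 2))) * (∑ x, |f x|) ^ 2 := by
      rw [pow_two, Finset.sum_mul_sum, Finset.mul_sum]
      refine Finset.sum_le_sum fun x _ => ?_
      rw [Finset.mul_sum]
      refine Finset.sum_le_sum fun y _ => (le_abs_self _).trans ?_
      rw [abs_mul, abs_mul, abs_mul, abs_of_pos (hw x)]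
      calc (Γ.degree (x : V) : ℝ) * |f x| * |f y| * |semigroupKernel (negProbLaplacian Γ) A t x y|
          ≤ M * |f x| * |f y| * (M * (k₅ * t ^ (-z / 2))) := by
            gcongr
            · exact hM x
            · exact hoff x y
        _ = _ := by ring
    have h3 : Real.exp (-(t * R)) * ∑ x, f x ^ 2 ≤
        M ^ 2 * k₅ * S.card * t ^ (-z / 2) * ∑ x, f x ^ 2 := by
      calc Real.exp (-(t * R)) * ∑ x, f x ^ 2
          ≤ Real.exp (-(t * R)) * ∑ x : A, (Γ.degree (x : V) : ℝ) * f x ^ 2 :=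
            mul_le_mul_of_nonneg_left hwf (Real.exp_pos _).le
        _ ≤ M * (M * (k₅ * t ^ (-z / 2))) * (∑ x, |f x|) ^ 2 := h1.trans h2
        _ ≤ M * (M * (k₅ * t ^ (-z / 2))) * (S.card * ∑ x, f x ^ 2) :=
            mul_le_mul_of_nonneg_left hcs (by positivity)
        _ = _ := by ring
    exact le_of_mul_le_mul_right h3 hf0
  set B : ℝ := Real.exp 1 * (M ^ 2 * k₅) * S.card with hB
  have hBpos : 0 < B := by positivity
  -- At this time the right side equals e⁻¹, so the exponent satisfies tR ≥ 1.
  have h1 := key (B ^ (2 / z)) (Real.rpow_pos_of_pos hBpos _)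
  have h2 : (B ^ (2 / z)) ^ (-z / 2) = B⁻¹ := by
    rw [← Real.rpow_mul hBpos.le, ← Real.rpow_neg_one]
    congr 1
    field_simp
  rw [h2] at h1
  have h3 : M ^ 2 * k₅ * S.card * B⁻¹ = Real.exp (-1) := by
    rw [Real.exp_neg, hB]
    field_simp
  rw [h3, Real.exp_le_exp] at h1
  linarith

/-- Lower volume bounds for balls inside `A`. -/
theorem exists_volume_lower_bound [Infinite V] (hconn : Γ.Connected) {M : ℕ}
    (hM : ∀ x, Γ.degree x ≤ M) {z k₅ : ℝ} (hz : 1 ≤ z) (hk₅ : 0 < k₅) :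
    ∃ m : ℝ, 0 < m ∧ ∀ A : Finset V,
      (∀ t : ℝ, 0 < t → ∀ x : A,
        |semigroupKernel (negProbLaplacian Γ) A t x x| ≤ k₅ * t ^ (-z / 2)) →
      (∀ f : A → ℝ, 0 ≤ f ⬝ᵥ dirichletRestriction (negCombLaplacian Γ) A *ᵥ f) →
      ∀ x₀ ∈ A, ∀ k : ℕ, 2 ^ k ≤ distToBoundary Γ A x₀ →
        m * ((2 : ℝ) ^ k) ^ z ≤ (ballIn Γ A x₀ (2 ^ k)).card := by
  have hMpos : (0 : ℝ) < M := by
    obtain ⟨x⟩ : Nonempty V := inferInstance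
    have : (Γ.degree x : ℝ) ≤ M := by exact_mod_cast hM x
    exact zero_lt_one.trans_le ((one_le_degree hconn x).trans this)
  have hz0 : 0 < z := by linarith
  set B : ℝ := (Real.exp 1 * (M ^ 2 * k₅)) ^ (2 / z) * (4 * M) with hB
  have hBpos : 0 < B := by positivity
  -- The 1 starts the induction at a single vertex; the other entry ensures B m^{2/z} ≤ 2^{-z},
  -- exactly the loss in one doubling.
  set m : ℝ := min 1 (((2 : ℝ) ^ (-z) / B) ^ (z / 2)) with hm
  have hmpos : 0 < m := lt_min zero_lt_one (by positivity)
  have hmB : B * m ^ (2 / z) ≤ (2 : ℝ) ^ (-z) := by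
    have h1 : m ^ (2 / z) ≤ (2 : ℝ) ^ (-z) / B := by
      calc m ^ (2 / z) ≤ (((2 : ℝ) ^ (-z) / B) ^ (z / 2)) ^ (2 / z) :=
            Real.rpow_le_rpow hmpos.le (min_le_right _ _) (by positivity)
        _ = (2 : ℝ) ^ (-z) / B := by
            rw [← Real.rpow_mul (by positivity)]
            have : z / 2 * (2 / z) = 1 := by field_simp
            rw [this, Real.rpow_one]
    rw [le_div_iff₀ hBpos] at h1
    linarith
  refine ⟨m, hmpos, fun A hdiag hpos x₀ hx₀ k => ?_⟩
  induction k with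
  | zero =>
    intro _
    have h1 : 1 ≤ (ballIn Γ A x₀ (2 ^ 0)).card :=
      Finset.card_pos.2 ⟨x₀, self_mem_ballIn hx₀ (by norm_num)⟩
    have h2 : (1 : ℝ) ≤ (ballIn Γ A x₀ (2 ^ 0)).card := by exact_mod_cast h1
    rw [pow_zero, Real.one_rpow, mul_one]
    exact (min_le_left _ _).trans h2
  | succ k ih =>
    intro hk
    have ih := ih ((Nat.pow_le_pow_right (by norm_num) (Nat.le_succ k)).trans hk)
    have hne : (ballIn Γ A x₀ (2 ^ (k + 1))).Nonempty :=
      ⟨x₀, self_mem_ballIn hx₀ (by positivity)⟩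
    set a : ℝ := ((ballIn Γ A x₀ (2 ^ (k + 1))).card : ℝ) with ha
    set b : ℝ := ((ballIn Γ A x₀ (2 ^ k)).card : ℝ) with hb
    have ha0 : 0 < a := by rw [ha]; exact_mod_cast hne.card_pos
    have hb0 : 0 < b := lt_of_lt_of_le (by positivity) ih
    obtain ⟨f, hf, hf1, hf2⟩ := exists_cutoff hconn hM hx₀ hk (s := 2 ^ k) (by rw [pow_succ]; omega)
    rw [← ha] at hf1
    rw [← hb] at hf2
    have hcast : (((2 ^ (k + 1) : ℕ) : ℝ) / 2) ^ 2 = (2 ^ k) ^ 2 := by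
      push_cast; rw [pow_succ]; ring
    rw [hcast] at hf2
    have hf0 : 0 < ∑ x, f x ^ 2 := lt_of_lt_of_le (by positivity) hf2
    have hFK := faberKrahn hconn hM hz hk₅ hdiag hpos hne hf hf0
      (R := M * a / ((2 ^ k) ^ 2 * b)) (by positivity) (by
        refine hf1.trans ?_
        rw [div_mul_eq_mul_div, le_div_iff₀ (by positivity)]
        exact mul_le_mul_of_nonneg_left hf2 (by positivity))
    rw [← ha, Real.mul_rpow (by positivity) ha0.le, ← mul_div_assoc, le_div_iff₀ (by positivity),
      one_mul] at hFK
    -- If the doubled ball were too small, Faber–Krahn for the tent would give b ≤ 2^{-z}a <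
    -- m(q/2)^z, contradicting the bound for the smaller ball.
    by_contra hlt
    push Not at hlt
    set q : ℝ := (2 : ℝ) ^ (k + 1) with hq
    have hqk : (2 : ℝ) ^ k = q / 2 := by rw [hq, pow_succ]; ring
    have hq0 : 0 < q := by positivity
    rw [hqk] at hFK ih
    have h1 : a ^ (2 / z) ≤ m ^ (2 / z) * q ^ 2 := by
      calc a ^ (2 / z) ≤ (m * q ^ z) ^ (2 / z) :=
            Real.rpow_le_rpow ha0.le hlt.le (by positivity)
        _ = m ^ (2 / z) * q ^ 2 := by
            rw [Real.mul_rpow hmpos.le (by positivity), ← Real.rpow_mul hq0.le]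
            have : z * (2 / z) = 2 := by field_simp
            rw [this]
            norm_num
    have h2 : q ^ 2 * b ≤ B * m ^ (2 / z) * q ^ 2 * a := by
      calc q ^ 2 * b = 4 * ((q / 2) ^ 2 * b) := by ring
        _ ≤ 4 * ((Real.exp 1 * (M ^ 2 * k₅)) ^ (2 / z) * a ^ (2 / z) * (M * a)) := by linarith
        _ = B * a ^ (2 / z) * a := by rw [hB]; ring
        _ ≤ B * (m ^ (2 / z) * q ^ 2) * a := by gcongr
        _ = _ := by ring
    have h3 : (q / 2) ^ z = q ^ z * 2 ^ (-z) := by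
      rw [Real.div_rpow hq0.le (by norm_num), Real.rpow_neg (by norm_num), div_eq_mul_inv]
    rw [h3] at ih
    have h4 : q ^ 2 * b < q ^ 2 * b := by
      calc q ^ 2 * b ≤ B * m ^ (2 / z) * q ^ 2 * a := h2
        _ ≤ 2 ^ (-z) * q ^ 2 * a := by gcongr
        _ < 2 ^ (-z) * q ^ 2 * (m * q ^ z) := by gcongr
        _ = q ^ 2 * (m * (q ^ z * 2 ^ (-z))) := by ring
        _ ≤ q ^ 2 * b := by gcongr
    exact lt_irrefl _ h4

/-- Trial functions with Rayleigh quotient of order `ρ_A⁻²`. -/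
theorem exists_trial_function [Infinite V] (hconn : Γ.Connected) {M : ℕ}
    (hM : ∀ x, Γ.degree x ≤ M) {CU z : ℝ} (hCU : 0 < CU) (hz : 1 ≤ z)
    (hvol : SphereGrowth Γ CU z) {k₅ : ℝ} (hk₅ : 0 < k₅) :
    ∃ c : ℝ, 0 < c ∧ ∀ A : Finset V, A.Nonempty →
      (∀ t : ℝ, 0 < t → ∀ x : A,
        |semigroupKernel (negProbLaplacian Γ) A t x x| ≤ k₅ * t ^ (-z / 2)) →
      (∀ f : A → ℝ, 0 ≤ f ⬝ᵥ dirichletRestriction (negCombLaplacian Γ) A *ᵥ f) →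
      ∃ f : A → ℝ, 0 < ∑ x, f x ^ 2 ∧
        f ⬝ᵥ dirichletRestriction (negCombLaplacian Γ) A *ᵥ f ≤
          c * ((inradius Γ A : ℝ) ^ 2)⁻¹ * ∑ x, f x ^ 2 := by
  have hMpos : (0 : ℝ) < M := by
    obtain ⟨x⟩ : Nonempty V := inferInstance
    have : (Γ.degree x : ℝ) ≤ M := by exact_mod_cast hM x
    exact zero_lt_one.trans_le ((one_le_degree hconn x).trans this)
  obtain ⟨m, hm, hvl⟩ := exists_volume_lower_bound hconn hM hz hk₅
  -- 16 = 4 · 4: one factor from the tent being at least q/2 on the smaller ball, the other from ρ ≤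
  -- 2q. The factor 2^z compares the two volumes.
  refine ⟨16 * M * (1 + CU) * 2 ^ z / m, by positivity, fun A hA hdiag hpos => ?_⟩
  obtain ⟨x₀, hx₀, hρ⟩ := Finset.exists_mem_eq_sup A hA (distToBoundary Γ A)
  have hρ1 := one_le_inradius hconn hA
  have hρ' : inradius Γ A = distToBoundary Γ A x₀ := hρ
  set ρ := inradius Γ A with hρdef
  set k := Nat.log 2 ρ with hk
  have hk1 : 2 ^ k ≤ ρ := Nat.pow_log_le_self 2 (by omega)
  have hk2 : ρ < 2 ^ (k + 1) := Nat.lt_pow_succ_log_self (by norm_num) ρ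
  have hkk : 2 ^ (k - 1) ≤ 2 ^ k := Nat.pow_le_pow_right (by norm_num) (Nat.sub_le k 1)
  -- For k = 0 truncated subtraction makes both radii equal to 1.
  have hs : 2 * 2 ^ (k - 1) ≤ 2 ^ k + 1 := by
    cases k with
    | zero => simp
    | succ n => rw [Nat.add_sub_cancel, pow_succ]; omega
  obtain ⟨f, -, hf1, hf2⟩ := exists_cutoff hconn hM hx₀ (hk1.trans hρ'.le) hs
  have hup := card_ballIn_le hconn hCU hz hvol A x₀ (r := 2 ^ k) Nat.one_le_two_pow
  have hlo := hvl A hdiag hpos x₀ hx₀ (k - 1) (hkk.trans (hk1.trans hρ'.le))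
  set q : ℝ := (2 : ℝ) ^ k with hq
  have hq0 : 0 < q := by positivity
  push_cast at hup hf2
  rw [← hq] at hup hf2
  have hq1 : q / 2 ≤ (2 : ℝ) ^ (k - 1) := by
    have h1 : 2 ^ k ≤ 2 ^ (k - 1) * 2 := by
      rw [← pow_succ]; exact Nat.pow_le_pow_right (by norm_num) (by omega)
    have h2 : q ≤ (2 : ℝ) ^ (k - 1) * 2 := by rw [hq]; exact_mod_cast h1
    linarith
  have hlo' : m * (q ^ z / 2 ^ z) ≤ (ballIn Γ A x₀ (2 ^ (k - 1))).card := by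
    refine le_trans ?_ hlo
    rw [← Real.div_rpow hq0.le (by norm_num)]
    have : 0 ≤ z := by linarith
    gcongr
  have hρq : (ρ : ℝ) ≤ 2 * q := by
    rw [hq, mul_comm, ← pow_succ]; exact_mod_cast hk2.le
  have hρ0 : (0 : ℝ) < ρ := by exact_mod_cast hρ1
  have hsum : (q / 2) ^ 2 * (m * (q ^ z / 2 ^ z)) ≤ ∑ x, f x ^ 2 :=
    le_trans (mul_le_mul_of_nonneg_left hlo' (sq_nonneg _)) hf2
  refine ⟨f, lt_of_lt_of_le (by positivity) hsum, ?_⟩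
  calc f ⬝ᵥ dirichletRestriction (negCombLaplacian Γ) A *ᵥ f
      ≤ M * ((1 + CU) * q ^ z) := hf1.trans (mul_le_mul_of_nonneg_left hup hMpos.le)
    _ = 16 * M * (1 + CU) * 2 ^ z / m * ((2 * q) ^ 2)⁻¹ *
          ((q / 2) ^ 2 * (m * (q ^ z / 2 ^ z))) := by
        field_simp
        ring
    _ ≤ 16 * M * (1 + CU) * 2 ^ z / m * ((ρ : ℝ) ^ 2)⁻¹ * ∑ x, f x ^ 2 := by
        gcongr

end FaberKrahn

/-! ### Sums of Gaussian and exponential weights over spheres -/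

section HeatSums

/-- A discrete arctangent integral, bounded uniformly in a by comparison with the telescoping terms
2a/((a+n)(a+n+1)). -/
theorem sum_div_sq_add_sq_le {a : ℝ} (ha : 0 < a) (N : ℕ) :
    ∑ r ∈ Finset.Icc 1 N, a / (a ^ 2 + (r : ℝ) ^ 2) ≤ 2 := by
  have h : ∀ N : ℕ, ∑ r ∈ Finset.Icc 1 N, a / (a ^ 2 + (r : ℝ) ^ 2) ≤ 2 - 2 * a / (a + N) := by
    intro N
    induction N with
    | zero => simp [ha.ne']
    | succ n ih =>
      rw [Finset.sum_Icc_succ_top (by omega)]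
      have hn : (0 : ℝ) ≤ n := Nat.cast_nonneg n
      have h1 : a / (a ^ 2 + ((n + 1 : ℕ) : ℝ) ^ 2) ≤
          2 * a / (a + n) - 2 * a / (a + ((n + 1 : ℕ) : ℝ)) := by
        push_cast
        rw [div_sub_div _ _ (by positivity) (by positivity),
          div_le_div_iff₀ (by positivity) (by positivity)]
        have : 2 * a * (a + (n + 1)) - (a + n) * (2 * a) = 2 * a := by ring
        rw [this]
        have h2 : (a + n) * (a + (n + 1)) ≤ 2 * (a ^ 2 + ((n : ℝ) + 1) ^ 2) := by
          nlinarith [sq_nonneg (a - (n + 1))]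
        linarith [mul_le_mul_of_nonneg_left h2 ha.le]
      linarith
  refine (h N).trans ?_
  have : 0 ≤ 2 * a / (a + N) := by positivity
  linarith

theorem exists_rpow_mul_exp_le {p k : ℝ} (hp : 0 ≤ p) (hk : 0 < k) :
    ∃ C : ℝ, 0 < C ∧ ∀ s : ℝ, 0 ≤ s → s ^ p * (1 + s) * Real.exp (-(k * s)) ≤ C := by
  set n := ⌈p⌉₊ + 1 with hn
  refine ⟨n.factorial / k ^ n * Real.exp k, by positivity, fun s hs => ?_⟩
  have h1 : s ^ p * (1 + s) ≤ (1 + s) ^ n := by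
    rw [hn, pow_succ]
    refine mul_le_mul_of_nonneg_right ?_ (by linarith)
    calc s ^ p ≤ (1 + s) ^ p := Real.rpow_le_rpow hs (by linarith) hp
      _ ≤ (1 + s) ^ (⌈p⌉₊ : ℝ) :=
        Real.rpow_le_rpow_of_exponent_le (by linarith) (Nat.le_ceil p)
      _ = _ := Real.rpow_natCast _ _
  have h2 := Real.pow_div_factorial_le_exp (k * (1 + s)) (by positivity) n
  rw [mul_pow, div_le_iff₀ (by positivity)] at h2
  rw [Real.exp_neg, ← div_eq_mul_inv, div_le_iff₀ (Real.exp_pos _)]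
  calc s ^ p * (1 + s) ≤ (1 + s) ^ n := h1
    _ = k ^ n * (1 + s) ^ n / k ^ n := by field_simp
    _ ≤ Real.exp (k * (1 + s)) * n.factorial / k ^ n := by gcongr
    _ = n.factorial / k ^ n * Real.exp k * Real.exp (k * s) := by
        rw [mul_assoc _ (Real.exp k), ← Real.exp_add]
        ring_nf

/-- With a = √t and s = r²/t, the exponential absorbs s^{(z-1)/2}(1+s), leaving C·a/(a²+r²),
summable uniformly in t. -/
theorem exists_gaussian_sum_le {z k : ℝ} (hz : 1 ≤ z) (hk : 0 < k) :
    ∃ C : ℝ, 0 < C ∧ ∀ t : ℝ, 0 < t → ∀ N : ℕ,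
      ∑ r ∈ Finset.Icc 1 N,
        (r : ℝ) ^ (z - 1) * (t ^ (-z / 2) * Real.exp (-(k * ((r : ℝ) ^ 2 / t)))) ≤ C := by
  obtain ⟨C, hC, h⟩ := exists_rpow_mul_exp_le (p := (z - 1) / 2) (by linarith) hk
  refine ⟨C * 2, by positivity, fun t ht N => ?_⟩
  set a := Real.sqrt t with ha
  have ha0 : 0 < a := Real.sqrt_pos.2 ht
  have hat : t = a ^ 2 := (Real.sq_sqrt ht.le).symm
  refine le_trans ?_ (mul_le_mul_of_nonneg_left (sum_div_sq_add_sq_le ha0 N) hC.le)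
  rw [Finset.mul_sum]
  refine Finset.sum_le_sum fun r hr => ?_
  have hr0 : (0 : ℝ) < r := by exact_mod_cast (Finset.mem_Icc.1 hr).1
  have h1 := h ((r : ℝ) ^ 2 / t) (by positivity)
  have h2 : ((r : ℝ) ^ 2 / t) ^ ((z - 1) / 2) = (r : ℝ) ^ (z - 1) / a ^ (z - 1) := by
    rw [hat, ← div_pow, ← Real.rpow_natCast, ← Real.rpow_mul (by positivity),
      ← Real.div_rpow hr0.le ha0.le]
    congr 1
    push_cast; ring
  have h3 : t ^ (-z / 2) = a⁻¹ / a ^ (z - 1) := by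
    rw [hat, ← Real.rpow_natCast, ← Real.rpow_mul ha0.le, ← Real.rpow_neg_one,
      ← Real.rpow_sub ha0]
    congr 1
    push_cast; ring
  rw [h2] at h1
  rw [h3]
  have h4 : 1 + (r : ℝ) ^ 2 / t = (a ^ 2 + (r : ℝ) ^ 2) / a ^ 2 := by
    rw [hat]; field_simp
  rw [h4] at h1
  have h5 : 0 < (a ^ 2 + (r : ℝ) ^ 2) := by positivity
  calc (r : ℝ) ^ (z - 1) * (a⁻¹ / a ^ (z - 1) * Real.exp (-(k * ((r : ℝ) ^ 2 / t))))
      = (r : ℝ) ^ (z - 1) / a ^ (z - 1) * ((a ^ 2 + (r : ℝ) ^ 2) / a ^ 2) *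
          Real.exp (-(k * ((r : ℝ) ^ 2 / t))) * (a / (a ^ 2 + (r : ℝ) ^ 2)) := by
        field_simp
    _ ≤ C * (a / (a ^ 2 + (r : ℝ) ^ 2)) := by gcongr

theorem exists_exponential_sum_le {z k : ℝ} (hz : 1 ≤ z) (hk : 0 < k) :
    ∃ C : ℝ, 0 < C ∧ ∀ N : ℕ,
      ∑ r ∈ Finset.Icc 1 N, (r : ℝ) ^ (z - 1) * Real.exp (-(k * r)) ≤ C := by
  obtain ⟨C, hC, h⟩ := exists_rpow_mul_exp_le (p := z) (by linarith) hk
  refine ⟨C * 2, by positivity, fun N => ?_⟩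
  refine le_trans ?_ (mul_le_mul_of_nonneg_left (sum_div_sq_add_sq_le zero_lt_one N) hC.le)
  rw [Finset.mul_sum]
  refine Finset.sum_le_sum fun r hr => ?_
  have hr1 : (1 : ℝ) ≤ r := by exact_mod_cast (Finset.mem_Icc.1 hr).1
  have hr0 : (0 : ℝ) < r := by linarith
  rw [mul_one_div, le_div_iff₀ (by positivity)]
  refine le_trans ?_ (h r hr0.le)
  rw [Real.rpow_sub_one hr0.ne']
  have h1 : (1 : ℝ) ^ 2 + (r : ℝ) ^ 2 ≤ r * (1 + r) := by nlinarith
  calc (r : ℝ) ^ z / r * Real.exp (-(k * r)) * (1 ^ 2 + (r : ℝ) ^ 2)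
      ≤ (r : ℝ) ^ z / r * Real.exp (-(k * r)) * (r * (1 + r)) := by gcongr
    _ = _ := by field_simp

/-- Two bounds imply their geometric mean; this lets half of the spatial exponent and half of the
temporal one be kept together. -/
theorem le_mul_of_le_mul_sq {p m a b : ℝ} (hm : 0 ≤ m) (ha : 0 ≤ a) (hb : 0 ≤ b)
    (h1 : p ≤ m * a ^ 2) (h2 : p ≤ m * b ^ 2) : p ≤ m * (a * b) := by
  rcases le_total a b with h | h
  · exact h1.trans (mul_le_mul_of_nonneg_left (by nlinarith) hm)
  · exact h2.trans (mul_le_mul_of_nonneg_left (by nlinarith) hm)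

end HeatSums

/-! ### Decay of the heat semigroup and Poisson bounds -/

section HeatKernel

variable {V : Type*} [DecidableEq V] {Γ : SimpleGraph V} [Γ.LocallyFinite]

/-- The heat semigroup decays exponentially on `ℓ^∞` at a rate comparable with the gap. -/
theorem exists_sum_semigroupKernel_le [Infinite V] (hconn : Γ.Connected) {M : ℕ}
    (hM : ∀ x, Γ.degree x ≤ M) {CU z : ℝ} (hCU : 0 < CU) (hz : 1 ≤ z)
    (hvol : SphereGrowth Γ CU z) {k₁ k₂ k₃ k₄ k₅ : ℝ} (hk₁ : 0 < k₁) (hk₂ : 0 < k₂)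
    (hk₃ : 0 < k₃) (hk₄ : 0 < k₄) (hk₅ : 0 < k₅) :
    ∃ C : ℝ, 0 < C ∧ ∀ A : Finset V,
      SemigroupKernelBounds Γ (negProbLaplacian Γ) A z k₁ k₂ k₃ k₄ k₅ →
      ∀ c : ℝ, 0 < c → (∀ f : A → ℝ, c * ∑ x : A, (Γ.degree (x : V) : ℝ) * f x ^ 2 ≤
        f ⬝ᵥ dirichletRestriction (negCombLaplacian Γ) A *ᵥ f) →
      ∀ t : ℝ, 0 < t → ∀ x : A,
        ∑ y, |semigroupKernel (negProbLaplacian Γ) A t x y| ≤ C * Real.exp (-(c / 4 * t)) := by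
  obtain ⟨C₁, hC₁, hexp⟩ := exists_exponential_sum_le hz (half_pos hk₄)
  obtain ⟨C₂, hC₂, hgauss⟩ := exists_gaussian_sum_le hz (half_pos hk₂)
  have hMpos : (0 : ℝ) < M := by
    obtain ⟨x⟩ : Nonempty V := inferInstance
    have : (Γ.degree x : ℝ) ≤ M := by exact_mod_cast hM x
    exact zero_lt_one.trans_le ((one_le_degree hconn x).trans this)
  set K : ℝ := k₁ + k₃ + M + M * k₅ * 2 ^ (z / 2) with hK
  have hMk : 0 < M * k₅ * 2 ^ (z / 2) := by positivity
  have hKpos : 0 < K := by positivity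
  refine ⟨M + CU * K * (C₁ + C₂), by positivity, fun A hker c hc hgap t ht x => ?_⟩
  have hw : ∀ x : A, (0 : ℝ) < Γ.degree (x : V) := fun x =>
    zero_lt_one.trans_le (one_le_degree hconn _)
  obtain ⟨Q, μ, hQ⟩ := exists_isSpectralDecomposition (dirichletRestriction_comb_isSymm Γ A) hw
  have hsimple : ∀ y : A, |semigroupKernel (negProbLaplacian Γ) A t x y| ≤
      M * Real.exp (-(t * c)) := fun y => by
    have := abs_semigroupKernel_le hconn hM hgap (K := 1) (s := 0) (fun x => by
      rw [semigroupKernel_prob, hQ.exp_zero_apply_self, abs_one]) ht.le x y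
    rw [zero_add, mul_one, mul_comm] at this
    exact this
  -- Half of the time supplies the on-diagonal factor t^{-z/2}, the other half the decay from the
  -- gap. The geometric mean halves the exponent again, giving the rate c/4.
  have hhalf : ∀ y : A, |semigroupKernel (negProbLaplacian Γ) A t x y| ≤
      M * k₅ * 2 ^ (z / 2) * t ^ (-z / 2) * Real.exp (-(t / 2 * c)) := fun y => by
    have := abs_semigroupKernel_le hconn hM hgap (s := t / 2)
      (fun x => (hker (t / 2) (half_pos ht) x x).2.2 rfl) (half_pos ht).le x y
    rw [add_halves] at this
    refine this.trans (le_of_eq ?_)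
    rw [Real.div_rpow ht.le (by norm_num), neg_div, Real.rpow_neg (x := 2) (by norm_num),
      div_inv_eq_mul]
    ring
  set e : ℝ := Real.exp (-(c / 4 * t)) with he
  have he0 : 0 < e := Real.exp_pos _
  have hct : 0 < c * t := mul_pos hc ht
  -- Adding the profiles of both time regimes gives one radial majorant, so the sum over y needs no
  -- splitting at d(x,y) = t.
  set g : ℕ → ℝ := fun r => K * (Real.exp (-(k₄ / 2 * r)) +
    t ^ (-z / 2) * Real.exp (-(k₂ / 2 * ((r : ℝ) ^ 2 / t)))) * e with hg
  have hg0 : ∀ r, 0 ≤ g r := fun r => by positivity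
  have hterm : ∀ y : A, x ≠ y →
      |semigroupKernel (negProbLaplacian Γ) A t x y| ≤ g (Γ.dist (x : V) y) := by
    intro y hxy
    have hd : 1 ≤ Γ.dist (x : V) y := hconn.pos_dist_of_ne fun h => hxy (Subtype.ext h)
    rcases le_or_gt (Γ.dist (x : V) y : ℝ) t with h | h
    · have h1 := (hker t ht x y).1 hd h
      have h2 : |semigroupKernel (negProbLaplacian Γ) A t x y| ≤ K * t ^ (-z / 2) *
          (Real.exp (-(k₂ / 2 * ((Γ.dist (x : V) y : ℝ) ^ 2 / t))) * e) := by
        refine le_mul_of_le_mul_sq (by positivity) (Real.exp_pos _).le he0.le ?_ ?_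
        · rw [← Real.exp_nat_mul]
          refine h1.trans ?_
          have hexp_eq : -k₂ * (Γ.dist (x : V) y : ℝ) ^ 2 / t =
              ((2 : ℕ) : ℝ) * -(k₂ / 2 * ((Γ.dist (x : V) y : ℝ) ^ 2 / t)) := by
            push_cast; ring
          rw [hexp_eq]
          have : k₁ ≤ K := by rw [hK]; linarith
          gcongr
        · rw [he, ← Real.exp_nat_mul]
          refine (hhalf y).trans ?_
          have hexp_eq : -(t / 2 * c) = ((2 : ℕ) : ℝ) * -(c / 4 * t) := by push_cast; ring
          rw [hexp_eq]
          have : M * k₅ * 2 ^ (z / 2) ≤ K := by rw [hK]; linarith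
          gcongr
      refine h2.trans ?_
      have : 0 ≤ K * Real.exp (-(k₄ / 2 * (Γ.dist (x : V) y : ℝ))) * e := by positivity
      simp only [hg]
      linarith
    · have h1 := (hker t ht x y).2.1 hd h
      have h2 : |semigroupKernel (negProbLaplacian Γ) A t x y| ≤ K *
          (Real.exp (-(k₄ / 2 * (Γ.dist (x : V) y : ℝ))) * e) := by
        refine le_mul_of_le_mul_sq (by positivity) (Real.exp_pos _).le he0.le ?_ ?_
        · rw [← Real.exp_nat_mul]
          refine h1.trans ?_
          have hexp_eq : -k₄ * (Γ.dist (x : V) y : ℝ) =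
              ((2 : ℕ) : ℝ) * -(k₄ / 2 * (Γ.dist (x : V) y : ℝ)) := by
            push_cast; ring
          rw [hexp_eq]
          have : k₃ ≤ K := by rw [hK]; linarith
          gcongr
        · rw [he, ← Real.exp_nat_mul]
          refine (hsimple y).trans ?_
          have hexp_le : -(t * c) ≤ ((2 : ℕ) : ℝ) * -(c / 4 * t) := by push_cast; linarith
          have : (M : ℝ) ≤ K := by rw [hK]; linarith
          gcongr
      refine h2.trans ?_
      have : 0 ≤ K * (t ^ (-z / 2) *
        Real.exp (-(k₂ / 2 * ((Γ.dist (x : V) y : ℝ) ^ 2 / t)))) * e := by positivity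
      simp only [hg]
      linarith
  set N := A.sup (Γ.dist (x : V)) with hN
  have h1 : ∑ y, |semigroupKernel (negProbLaplacian Γ) A t x y| ≤
      M * e + ∑ v ∈ A.erase x, g (Γ.dist (x : V) v) := by
    rw [← Finset.add_sum_erase _ _ (Finset.mem_univ x)]
    refine add_le_add ((hsimple x).trans ?_) ?_
    · have : -(t * c) ≤ -(c / 4 * t) := by linarith
      rw [he]
      gcongr
    · have : ∑ v ∈ A.erase x, g (Γ.dist (x : V) v) =
          ∑ y ∈ (Finset.univ : Finset A).erase x, g (Γ.dist (x : V) y) := by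
        refine (Finset.sum_bij (fun (y : A) _ => (y : V)) ?_ ?_ ?_ ?_).symm
        · intro y hy
          exact Finset.mem_erase.2 ⟨fun h => (Finset.mem_erase.1 hy).1 (Subtype.ext h), y.2⟩
        · exact fun y _ y' _ h => Subtype.ext h
        · intro v hv
          obtain ⟨hv1, hv2⟩ := Finset.mem_erase.1 hv
          exact ⟨⟨v, hv2⟩, Finset.mem_erase.2 ⟨fun h => hv1 (congrArg Subtype.val h),
            Finset.mem_univ _⟩, rfl⟩
        · exact fun _ _ => rfl
      rw [this]
      exact Finset.sum_le_sum fun y hy => hterm y (Finset.mem_erase.1 hy).1.symm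
  have h2 := sum_radial_le hconn hvol (A.erase x) x hg0 (N := N)
    (fun y hy => Finset.le_sup (f := Γ.dist (x : V)) (Finset.mem_of_mem_erase hy))
    (Finset.notMem_erase _ _)
  have h3 : ∑ r ∈ Finset.Icc 1 N, CU * (r : ℝ) ^ (z - 1) * g r =
      CU * K * (∑ r ∈ Finset.Icc 1 N, (r : ℝ) ^ (z - 1) * Real.exp (-(k₄ / 2 * r)) +
        ∑ r ∈ Finset.Icc 1 N, (r : ℝ) ^ (z - 1) *
          (t ^ (-z / 2) * Real.exp (-(k₂ / 2 * ((r : ℝ) ^ 2 / t))))) * e := by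
    rw [← Finset.sum_add_distrib, Finset.mul_sum, Finset.sum_mul]
    exact Finset.sum_congr rfl fun r _ => by simp only [hg]; ring
  have h4 : ∑ r ∈ Finset.Icc 1 N, CU * (r : ℝ) ^ (z - 1) * g r ≤ CU * K * (C₁ + C₂) * e := by
    rw [h3]
    have h5 := hexp N
    have h6 := hgauss t ht N
    gcongr
  linarith

/-- An `ℓ^∞` bound for solutions of Poisson problems on `A`. -/
theorem exists_abs_le_of_poisson [Infinite V] (hconn : Γ.Connected) {M : ℕ}
    (hM : ∀ x, Γ.degree x ≤ M) {CU z : ℝ} (hCU : 0 < CU) (hz : 1 ≤ z)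
    (hvol : SphereGrowth Γ CU z) {k₁ k₂ k₃ k₄ k₅ : ℝ} (hk₁ : 0 < k₁) (hk₂ : 0 < k₂)
    (hk₃ : 0 < k₃) (hk₄ : 0 < k₄) (hk₅ : 0 < k₅) :
    ∃ C : ℝ, 0 < C ∧ ∀ A : Finset V,
      SemigroupKernelBounds Γ (negProbLaplacian Γ) A z k₁ k₂ k₃ k₄ k₅ →
      ∀ c : ℝ, 0 < c → (∀ f : A → ℝ, c * ∑ x : A, (Γ.degree (x : V) : ℝ) * f x ^ 2 ≤
        f ⬝ᵥ dirichletRestriction (negCombLaplacian Γ) A *ᵥ f) →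
      ∀ v : A → ℝ, (∀ x, |(dirichletRestriction (negProbLaplacian Γ) A *ᵥ v) x| ≤ 1) →
        ‖v‖ ≤ C / c := by
  obtain ⟨C, hC, h⟩ := exists_sum_semigroupKernel_le hconn hM hCU hz hvol hk₁ hk₂ hk₃ hk₄ hk₅
  refine ⟨4 * C, by positivity, fun A hker c hc hgap v hv => ?_⟩
  have hw : ∀ x : A, (0 : ℝ) < Γ.degree (x : V) := fun x =>
    zero_lt_one.trans_le (one_le_degree hconn _)
  obtain ⟨Q, μ, hQ⟩ := exists_isSpectralDecomposition (dirichletRestriction_comb_isSymm Γ A) hw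
  refine (pi_norm_le_iff_of_nonneg (by positivity)).2 fun x => ?_
  have hμ : ∀ i, 0 < μ i := fun i => hc.trans_le (hQ.le_of_form_lower_bound hw hgap i)
  have h1 := hQ.abs_le_of_sum_exp_le hμ (C := C) (κ := c / 4) (by positivity) x
    (fun t ht => by
      have := h A hker c hc hgap t ht x
      simpa only [semigroupKernel_prob] using this) v
    (by rwa [dirichletRestriction_prob] at hv)
  rw [Real.norm_eq_abs]
  refine h1.trans (le_of_eq ?_)
  field_simp

end HeatKernel

/-! ### Assembly of the two-sided bounds -/

section Bounds

variable {ι : Type*} [Fintype ι] [DecidableEq ι]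

theorem form_pos_of_gap {ι : Type*} [Fintype ι] {L : Matrix ι ι ℝ} {w : ι → ℝ}
    (hw : ∀ x, 0 < w x) {c : ℝ} (hc : 0 < c)
    (hgap : ∀ f : ι → ℝ, c * ∑ x, w x * f x ^ 2 ≤ f ⬝ᵥ L *ᵥ f) {f : ι → ℝ} (hf : f ≠ 0) :
    0 < f ⬝ᵥ L *ᵥ f := by
  obtain ⟨x, hx⟩ := Function.ne_iff.1 hf
  refine lt_of_lt_of_le (mul_pos hc ?_) (hgap f)
  exact Finset.sum_pos' (fun y _ => mul_nonneg (hw y).le (sq_nonneg _))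
    ⟨x, Finset.mem_univ _, mul_pos (hw x) (sq_pos_of_ne_zero hx)⟩

/-- Ground state energy bounds and the lower landscape bound from a spectral gap and a
trial function. -/
theorem eigenvalue_and_landscape_bounds [Nonempty ι] {L : Matrix ι ι ℝ} (hL : L.IsSymm)
    (hoff : ∀ x y, x ≠ y → L x y ≤ 0) {w : ι → ℝ} (hw : ∀ x, 1 ≤ w x) {c b : ℝ} (hc : 0 < c)
    (hgap : ∀ f : ι → ℝ, c * ∑ x, w x * f x ^ 2 ≤ f ⬝ᵥ L *ᵥ f) {f : ι → ℝ}
    (hf0 : 0 < ∑ x, f x ^ 2) (hf : f ⬝ᵥ L *ᵥ f ≤ b * ∑ x, f x ^ 2) :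
    b⁻¹ ≤ ‖(diagonal (fun x => (w x)⁻¹) * L)⁻¹ *ᵥ (1 : ι → ℝ)‖ ∧
      c ≤ sInf {ν : ℝ | Module.End.HasEigenvalue
        (Matrix.toLin' (diagonal (fun x => (w x)⁻¹) * L)) ν} ∧
      sInf {ν : ℝ | Module.End.HasEigenvalue
        (Matrix.toLin' (diagonal (fun x => (w x)⁻¹) * L)) ν} ≤ b := by
  have hw0 : ∀ x, 0 < w x := fun x => zero_lt_one.trans_le (hw x)
  have hlow := le_sInf_eigenvalues hL hw0 fun ν hν => le_eigenvalue hw0 hgap hν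
  have hup : sInf {ν : ℝ | Module.End.HasEigenvalue
        (Matrix.toLin' (diagonal (fun x => (w x)⁻¹) * L)) ν} ≤ b := by
    have h1 := sInf_eigenvalues_le hL hw0 hgap f
    -- As the weights are at least 1, an unweighted Rayleigh bound suffices, and one trial function
    -- serves both operators.
    have h2 : ∑ x, f x ^ 2 ≤ ∑ x, w x * f x ^ 2 :=
      Finset.sum_le_sum fun x _ => le_mul_of_one_le_left (sq_nonneg _) (hw x)
    exact le_of_mul_le_mul_right
      (((mul_le_mul_of_nonneg_left h2 (hc.le.trans hlow)).trans h1).trans hf) hf0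
  refine ⟨?_, hlow, hup⟩
  have hpos : ∀ f : ι → ℝ, f ≠ 0 → 0 < f ⬝ᵥ L *ᵥ f := fun _ => form_pos_of_gap hw0 hc hgap
  set u := (diagonal (fun x => (w x)⁻¹) * L)⁻¹ *ᵥ (1 : ι → ℝ)
  have hν : ∀ ν, Module.End.HasEigenvalue
      (Matrix.toLin' (diagonal (fun x => (w x)⁻¹) * L)) ν → 0 < ‖u‖ ∧ ‖u‖⁻¹ ≤ ν := by
    intro ν hν
    have hν0 : 0 < ν := hc.trans_le (le_eigenvalue hw0 hgap hν)
    have h1 : 1 ≤ ν * ‖u‖ := one_le_eigenvalue_mul_norm hw0 hoff hpos hν0 hν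
    have hu : 0 < ‖u‖ := pos_of_mul_pos_right (zero_lt_one.trans_le h1) hν0.le
    exact ⟨hu, (inv_le_iff_one_le_mul₀ hu).2 h1⟩
  obtain ⟨Q, μ, h⟩ := exists_isSpectralDecomposition hL hw0
  have hu := (hν _ (h.hasEigenvalue (Classical.arbitrary ι))).1
  exact inv_le_of_inv_le₀ hu
    ((le_sInf_eigenvalues hL hw0 fun ν h => (hν ν h).2).trans hup)

end Bounds

theorem bounds_of_hardy_of_trial {V : Type*} [DecidableEq V] [Infinite V] {Γ : SimpleGraph V}
    [Γ.LocallyFinite] (hconn : Γ.Connected) {A : Finset V} (hA : A.Nonempty) {CA b C : ℝ}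
    (hCA : 0 < CA) (hHardy : HardyInequality Γ A CA)
    {f : A → ℝ} (hf0 : 0 < ∑ x, f x ^ 2)
    (hf : f ⬝ᵥ dirichletRestriction (negCombLaplacian Γ) A *ᵥ f ≤
      b * ((inradius Γ A : ℝ) ^ 2)⁻¹ * ∑ x, f x ^ 2)
    (hpoisson : ∀ c : ℝ, 0 < c →
      (∀ f : A → ℝ, c * ∑ x : A, (Γ.degree (x : V) : ℝ) * f x ^ 2 ≤
        f ⬝ᵥ dirichletRestriction (negCombLaplacian Γ) A *ᵥ f) →
      ∀ v : A → ℝ, (∀ x, |(dirichletRestriction (negProbLaplacian Γ) A *ᵥ v) x| ≤ 1) →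
        ‖v‖ ≤ C / c) :
    (b⁻¹ * (inradius Γ A : ℝ) ^ 2 ≤ ‖landscape (negProbLaplacian Γ) A‖ ∧
      ‖landscape (negProbLaplacian Γ) A‖ ≤ C * (2 * CA) * (inradius Γ A : ℝ) ^ 2) ∧
    (b⁻¹ * (inradius Γ A : ℝ) ^ 2 ≤ ‖landscape (negCombLaplacian Γ) A‖ ∧
      ‖landscape (negCombLaplacian Γ) A‖ ≤ C * (2 * CA) * (inradius Γ A : ℝ) ^ 2) ∧
    ((2 * CA)⁻¹ * ((inradius Γ A : ℝ) ^ 2)⁻¹ ≤ groundStateEnergy (negProbLaplacian Γ) A ∧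
      groundStateEnergy (negProbLaplacian Γ) A ≤ b * ((inradius Γ A : ℝ) ^ 2)⁻¹) ∧
    ((2 * CA)⁻¹ * ((inradius Γ A : ℝ) ^ 2)⁻¹ ≤ groundStateEnergy (negCombLaplacian Γ) A ∧
      groundStateEnergy (negCombLaplacian Γ) A ≤ b * ((inradius Γ A : ℝ) ^ 2)⁻¹) := by
  have hne : Nonempty A := hA.to_subtype
  have hρ : (0 : ℝ) < inradius Γ A := by exact_mod_cast one_le_inradius hconn hA
  have hw1 : ∀ x : A, (1 : ℝ) ≤ Γ.degree (x : V) := fun x => one_le_degree hconn _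
  have hw0 : ∀ x : A, (0 : ℝ) < Γ.degree (x : V) := fun x => zero_lt_one.trans_le (hw1 x)
  have hgap := spectral_gap_of_hardy hconn hCA hHardy
  set c : ℝ := (2 * CA)⁻¹ * ((inradius Γ A : ℝ) ^ 2)⁻¹ with hc
  have hc0 : 0 < c := by positivity
  have hgap₁ : ∀ f : A → ℝ, c * ∑ x : A, (1 : ℝ) * f x ^ 2 ≤
      f ⬝ᵥ dirichletRestriction (negCombLaplacian Γ) A *ᵥ f := fun f =>
    le_trans (mul_le_mul_of_nonneg_left (Finset.sum_le_sum fun x _ =>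
      mul_le_mul_of_nonneg_right (hw1 x) (sq_nonneg _)) hc0.le) (hgap f)
  have hsymm := dirichletRestriction_comb_isSymm Γ A
  have hoff := dirichletRestriction_comb_nonpos Γ A
  obtain ⟨hp1, hp2, hp3⟩ := eigenvalue_and_landscape_bounds hsymm hoff hw1 hc0 hgap hf0 hf
  obtain ⟨hc1, hc2, hc3⟩ := eigenvalue_and_landscape_bounds hsymm hoff
    (w := fun _ => (1 : ℝ)) (fun _ => le_rfl) hc0 hgap₁ hf0 hf
  have hup := mulVec_inv_mulVec hw0 (fun _ => form_pos_of_gap hw0 hc0 hgap) (1 : A → ℝ)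
  have huc := mulVec_inv_mulVec (w := fun _ => (1 : ℝ)) (fun _ => zero_lt_one)
    (fun _ => form_pos_of_gap (fun _ => zero_lt_one) hc0 hgap₁) (1 : A → ℝ)
  rw [← dirichletRestriction_prob] at hp1 hp2 hp3 hup
  rw [← dirichletRestriction_comb] at hc1 hc2 hc3 huc
  rw [mul_inv, inv_inv] at hp1 hc1
  have hCc : C / c = C * (2 * CA) * (inradius Γ A : ℝ) ^ 2 := by
    rw [hc]; field_simp
  rw [← hCc]
  refine ⟨⟨hp1, hpoisson c hc0 hgap _ fun x => ?_⟩, ⟨hc1, hpoisson c hc0 hgap _ fun x => ?_⟩,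
    ⟨hp2, hp3⟩, ⟨hc2, hc3⟩⟩
  · rw [landscape, hup]
    simp
  -- The probabilistic operator sends the combinatorial landscape to 1/deg ≤ 1, so no kernel bound
  -- for the combinatorial semigroup is needed.
  · rw [landscape, dirichletRestriction_prob, ← mulVec_mulVec, huc, mulVec_diagonal,
      Pi.one_apply, mul_one, abs_of_pos (inv_pos.2 (hw0 x))]
    exact inv_le_one_of_one_le₀ (hw1 x)

end GraphLandscape

theorem mainTheorem6 {V : Type*} [DecidableEq V] [Countable V] [Infinite V]
    (Γ : SimpleGraph V) [Γ.LocallyFinite] (hconn : Γ.Connected)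
    (hdeg : ∃ M : ℕ, ∀ x : V, Γ.degree x ≤ M)
    (CU z : ℝ) (hCU : 0 < CU) (hz : 1 ≤ z) (hvol : GraphLandscape.SphereGrowth Γ CU z)
    (k₁ k₂ k₃ k₄ k₅ : ℝ) (hk₁ : 0 < k₁) (hk₂ : 0 < k₂) (hk₃ : 0 < k₃) (hk₄ : 0 < k₄)
    (hk₅ : 0 < k₅) (CA : ℝ) (hCA : 0 < CA) :
    ∃ c₁ c₂ c₃ c₄ : ℝ, 0 < c₁ ∧ 0 < c₂ ∧ 0 < c₃ ∧ 0 < c₄ ∧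
      ∀ A : Finset V, A.Nonempty →
        GraphLandscape.SemigroupKernelBounds Γ (GraphLandscape.negProbLaplacian Γ) A
          z k₁ k₂ k₃ k₄ k₅ →
        GraphLandscape.HardyInequality Γ A CA →
        (c₁ * (GraphLandscape.inradius Γ A : ℝ) ^ 2
            ≤ ‖GraphLandscape.landscape (GraphLandscape.negProbLaplacian Γ) A‖ ∧
          ‖GraphLandscape.landscape (GraphLandscape.negProbLaplacian Γ) A‖
            ≤ c₂ * (GraphLandscape.inradius Γ A : ℝ) ^ 2) ∧
        (c₁ * (GraphLandscape.inradius Γ A : ℝ) ^ 2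
            ≤ ‖GraphLandscape.landscape (GraphLandscape.negCombLaplacian Γ) A‖ ∧
          ‖GraphLandscape.landscape (GraphLandscape.negCombLaplacian Γ) A‖
            ≤ c₂ * (GraphLandscape.inradius Γ A : ℝ) ^ 2) ∧
        (c₃ * ((GraphLandscape.inradius Γ A : ℝ) ^ 2)⁻¹
            ≤ GraphLandscape.groundStateEnergy (GraphLandscape.negProbLaplacian Γ) A ∧
          GraphLandscape.groundStateEnergy (GraphLandscape.negProbLaplacian Γ) A
            ≤ c₄ * ((GraphLandscape.inradius Γ A : ℝ) ^ 2)⁻¹) ∧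
        (c₃ * ((GraphLandscape.inradius Γ A : ℝ) ^ 2)⁻¹
            ≤ GraphLandscape.groundStateEnergy (GraphLandscape.negCombLaplacian Γ) A ∧
          GraphLandscape.groundStateEnergy (GraphLandscape.negCombLaplacian Γ) A
            ≤ c₄ * ((GraphLandscape.inradius Γ A : ℝ) ^ 2)⁻¹) := by
  obtain ⟨M, hM⟩ := hdeg
  obtain ⟨b, hb, htrial⟩ := GraphLandscape.exists_trial_function hconn hM hCU hz hvol hk₅
  obtain ⟨C, hC, hpoisson⟩ := GraphLandscape.exists_abs_le_of_poisson hconn hM hCU hz hvol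
    hk₁ hk₂ hk₃ hk₄ hk₅
  refine ⟨b⁻¹, C * (2 * CA), (2 * CA)⁻¹, b, by positivity, by positivity, by positivity, hb,
    fun A hA hker hHardy => ?_⟩
  have hdeg0 : ∀ f : A → ℝ, 0 ≤ ∑ x : A, (Γ.degree (x : V) : ℝ) * f x ^ 2 := fun f =>
    Finset.sum_nonneg fun x _ => mul_nonneg (Nat.cast_nonneg _) (sq_nonneg _)
  obtain ⟨f, hf0, hf⟩ := htrial A hA (fun t ht x => (hker t ht x x).2.2 rfl) fun f =>
    le_trans (mul_nonneg (by positivity) (hdeg0 f))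
      (GraphLandscape.spectral_gap_of_hardy hconn hCA hHardy f)
  exact GraphLandscape.bounds_of_hardy_of_trial hconn hA hCA hHardy hf0 hf (hpoisson A hker)
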